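/- Let $\rho$ be the Dickman--de Bruijn function: the continuous function on $[0,\infty)$ with $\rho(w)=1$ for $0\le w\le 1$ and $w\rho'(w)=-\rho(w-1)$ for $w>1$. Let $\chi:[0,\infty)\to\mathbb{R}$ be a measurable function with $\chi(t)=1$ for $0\le t\le 1$ and $\chi(t)\in[0,1]$ for all $t>1$. Let $\sigma:[0,\infty)\to\mathbb{R}$ be the corresponding continuous solution of the integral equation given by $\sigma(u)=1$ for $0\le u\le 1$ and $$u\,\sigma(u)=\int_0^u \chi(t)\,\sigma(u-t)\,dt\qquad (u>1),$$ and put $$E_\chi(u)=\exp\Big(\int_0^u\frac{1-\chi(t)}{t}\,dt\Big).$$ Then, writing $E=E_\chi$, for all $u\ge 0$: (i) $\sigma(u)\ge\rho(E(u))$. (ii) If $1\le E(u)\le 2$ and $\sigma(u)=\rho(E(u))$, then $E(u/2)=1$. (iii) If $E(u)\ge 2$ and $\sigma(u)=\rho(E(u))$, then $E(u/E(u))=1$; moreover $\chi(t)=1$ for almost all $t\in[0,u/E(u)]$ and $\chi(t)=0$ for almost all $t\in[u/E(u),u]$. In particular, for every $w\ge 1$, the minimum of $\sigma(u)$ over all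 such $\chi$ (with corresponding solution $\sigma$) and all $u\ge 1$ with $E_\chi(u)=w$ exists and equals $\rho(w)$. -/

import Mathlib

open MeasureTheory Set

noncomputable section

/-- Picard iterates for the delay differential equation `w ρ'(w) = -ρ(w - 1)`, `w > 1`, with
`ρ = 1` on `[0,1]`: the `n`-th iterate is already equal to `ρ` on `[0, n + 1]`. -/
def dickmanIter : ℕ → ℝ → ℝ
  | 0 => fun _ => 1
  | n + 1 => fun w => 1 - ∫ t in (1 : ℝ)..(max 1 w), dickmanIter n (t - 1) / t

/-- The Dickman--de Bruijn function `ρ` : the continuous function with `ρ(w) = 1` for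
`0 ≤ w ≤ 1` and `w ρ'(w) = -ρ(w - 1)` for `w > 1` (these properties are proved below in
`dickmanRho_of_le_one`, `continuous_dickmanRho`, `hasDerivAt_dickmanRho`). -/
def dickmanRho (w : ℝ) : ℝ := dickmanIter ⌈w⌉₊ w

/-- The class of functions `χ` on `[0, ∞)`: (Lebesgue) measurable, `χ(t) = 1` for
`0 ≤ t ≤ 1`, and `χ(t) ∈ [0,1]` for `t > 1`.  Values at negative arguments play no role. -/
structure IsChi (χ : ℝ → ℝ) : Prop where
  aemeasurable : AEMeasurable χ (volume.restrict (Ici 0))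
  eq_one : ∀ t, 0 ≤ t → t ≤ 1 → χ t = 1
  mem_Icc : ∀ t, 1 < t → χ t ∈ Icc (0 : ℝ) 1

/-- `σ` is the (continuous) solution on `[0, ∞)` of the integral equation attached to `χ`:
`σ(u) = 1` for `0 ≤ u ≤ 1` and `u σ(u) = ∫₀ᵘ χ(t) σ(u - t) dt` for `u > 1`. -/
structure IsSigma (χ σ : ℝ → ℝ) : Prop where
  continuousOn : ContinuousOn σ (Ici 0)
  eq_one : ∀ u, 0 ≤ u → u ≤ 1 → σ u = 1
  integral_eq : ∀ u, 1 < u → u * σ u = ∫ t in (0 : ℝ)..u, χ t * σ (u - t)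

/-- `E_χ(u) = exp (∫₀ᵘ (1 - χ(t)) / t dt)`. -/
def Echi (χ : ℝ → ℝ) (u : ℝ) : ℝ := Real.exp (∫ t in (0 : ℝ)..u, (1 - χ t) / t)

/-- All values `σ(u)`, over all admissible `χ` with solution `σ` and all `u ≥ 1` such that
`E_χ(u) = w`. -/
def sigmaValues (w : ℝ) : Set ℝ :=
  {s | ∃ (χ σ : ℝ → ℝ) (u : ℝ), IsChi χ ∧ IsSigma χ σ ∧ 1 ≤ u ∧ Echi χ u = w ∧ s = σ u}

theorem continuousOn_dickman_integrand {f : ℝ → ℝ} (hf : Continuous f) :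
    ContinuousOn (fun t : ℝ => f (t - 1) / t) (Ici 1) := by
  refine ContinuousOn.div (by fun_prop) continuousOn_id ?_
  intro t ht h
  have h1 : (1 : ℝ) ≤ t := ht
  have h2 : t = 0 := h
  linarith

theorem hasDerivAt_dickman_integral {f : ℝ → ℝ} (hf : Continuous f) {w : ℝ} (hw : 1 < w) :
    HasDerivAt (fun w => 1 - ∫ t in (1 : ℝ)..(max 1 w), f (t - 1) / t) (-(f (w - 1) / w)) w := by
  have hc := continuousOn_dickman_integrand hf
  have h1 : HasDerivAt (fun v => ∫ t in (1 : ℝ)..v, f (t - 1) / t) (f (w - 1) / w) w := by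
    refine intervalIntegral.integral_hasDerivAt_right ?_ ?_ ?_
    · apply ContinuousOn.intervalIntegrable
      rw [uIcc_of_le hw.le]
      exact hc.mono Icc_subset_Ici_self
    · exact (hc.mono Ioi_subset_Ici_self).stronglyMeasurableAtFilter isOpen_Ioi w hw
    · exact hc.continuousAt (Ici_mem_nhds hw)
  have h2 := h1.const_sub 1
  refine h2.congr_of_eventuallyEq ?_
  filter_upwards [Ioi_mem_nhds hw] with v hv
  rw [max_eq_right (le_of_lt hv)]

theorem continuous_dickmanIter (n : ℕ) : Continuous (dickmanIter n) := by
  induction n with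
  | zero => exact continuous_const
  | succ n ih =>
    rw [continuous_iff_continuousAt]
    have hc := continuousOn_dickman_integrand ih
    have hg : Continuous (fun t : ℝ => dickmanIter n (max 1 t - 1) / max 1 t) := by
      refine Continuous.div (by fun_prop) (by fun_prop) ?_
      intro t h
      have := le_max_left 1 t
      linarith
    have hP : Continuous
        (fun v : ℝ => ∫ t in (1 : ℝ)..v, dickmanIter n (max 1 t - 1) / max 1 t) :=
      intervalIntegral.continuous_primitive (fun a b => hg.intervalIntegrable a b) 1
    have hQ : dickmanIter (n + 1) = fun w =>
        1 - ∫ t in (1 : ℝ)..(max 1 w), dickmanIter n (max 1 t - 1) / max 1 t := by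
      funext w
      change 1 - ∫ t in (1 : ℝ)..(max 1 w), dickmanIter n (t - 1) / t = _
      congr 1
      refine intervalIntegral.integral_congr ?_
      intro t ht
      rw [uIcc_of_le (le_max_left 1 w)] at ht
      simp only [max_eq_right ht.1]
    rw [hQ]
    intro w
    exact (continuous_const.sub
      (hP.comp (continuous_const.max continuous_id))).continuousAt

theorem dickmanIter_succ_eq (n : ℕ) :
    ∀ w : ℝ, w ≤ n + 1 → dickmanIter (n + 1) w = dickmanIter n w := by
  induction n with
  | zero =>
    intro w hw
    have h : max 1 w = 1 := max_eq_left (by simpa using hw)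
    simp [dickmanIter, h]
  | succ n ih =>
    intro w hw
    push_cast at hw
    change 1 - ∫ t in (1 : ℝ)..(max 1 w), dickmanIter (n + 1) (t - 1) / t
      = 1 - ∫ t in (1 : ℝ)..(max 1 w), dickmanIter n (t - 1) / t
    congr 1
    refine intervalIntegral.integral_congr ?_
    intro t ht
    rw [uIcc_of_le (le_max_left 1 w)] at ht
    have ht2 : t ≤ n + 1 + 1 :=
      ht.2.trans (max_le (by linarith [(Nat.cast_nonneg n : (0 : ℝ) ≤ n)]) hw)
    simp only
    rw [ih (t - 1) (by linarith)]

theorem dickmanIter_eq_of_le {m n : ℕ} (hmn : m ≤ n) {w : ℝ} (hw : w ≤ m + 1) :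
    dickmanIter n w = dickmanIter m w := by
  induction n, hmn using Nat.le_induction with
  | base => rfl
  | succ n hn ih =>
    rw [dickmanIter_succ_eq n w ?_, ih]
    have : (m : ℝ) ≤ n := by exact_mod_cast hn
    linarith

theorem dickmanRho_eq_iter (n : ℕ) {w : ℝ} (hw : w ≤ n + 1) :
    dickmanRho w = dickmanIter n w := by
  unfold dickmanRho
  rcases le_total n ⌈w⌉₊ with h | h
  · exact dickmanIter_eq_of_le h hw
  · exact (dickmanIter_eq_of_le h ((Nat.le_ceil w).trans (by linarith))).symm

theorem dickmanRho_of_le_one {w : ℝ} (hw : w ≤ 1) : dickmanRho w = 1 := by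
  rw [dickmanRho_eq_iter 0 (by simpa using hw)]
  rfl

theorem dickmanRho_eventuallyEq (w : ℝ) :
    dickmanRho =ᶠ[nhds w] dickmanIter (⌈w⌉₊ + 1) := by
  have h : w < ⌈w⌉₊ + 1 := (Nat.le_ceil w).trans_lt (by linarith)
  filter_upwards [Iio_mem_nhds h] with v hv
  have hv' : v < ⌈w⌉₊ + 1 := hv
  exact dickmanRho_eq_iter _ (by push_cast; linarith)

theorem continuous_dickmanRho : Continuous dickmanRho := by
  rw [continuous_iff_continuousAt]
  intro w
  exact (continuous_dickmanIter _).continuousAt.congr (dickmanRho_eventuallyEq w).symm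

theorem hasDerivAt_dickmanRho {w : ℝ} (hw : 1 < w) :
    HasDerivAt dickmanRho (-(dickmanRho (w - 1) / w)) w := by
  have h1 : HasDerivAt (dickmanIter (⌈w⌉₊ + 1)) (-(dickmanIter ⌈w⌉₊ (w - 1) / w)) w :=
    hasDerivAt_dickman_integral (continuous_dickmanIter _) hw
  have h2 : w - 1 ≤ ⌈w⌉₊ + 1 := by linarith [Nat.le_ceil w]
  rw [dickmanRho_eq_iter _ h2]
  exact h1.congr_of_eventuallyEq (dickmanRho_eventuallyEq w)

end

/-!
# The Dickman function as the minimum of solutions of a convolution equation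

Write `w = E(u)`. If `w ≤ 2` then `ρ(w) = 1 - log w`, and `σ(u) ≥ 1 - log E(u)` is the first
inclusion-exclusion inequality. It follows from a minimum principle for the integral equation
(`IsKernel.nonneg_of_integral_le`, `IsKernel.one_sub_logDefect_le`), because
`∫₀ᵘ χ(t) (1 - log E(u - t)) dt` exceeds `u (1 - log E(u))` by `∫₀ᵘ (1 - χ(t)) log E(u - t) dt`.
This excess is positive as soon as `E(u / 2) > 1`, which settles the case of equality.

Let `w > 2`. For `u / 2 ≤ T ≤ u` replace `χ` by `0` on `(T, ∞)`, and let `σ_T`, `E_T` belong to the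
new kernel, so that `E_T(u) = E(T) u / T`. Since `u ≤ 2 T`, the difference
`σ(u) - σ_T(u)` equals `∫_T^u σ(u - t) χ(t) / t dt` (`SolvesUpTo.trunc`), and hence
(`IsKernel.sub_dickmanRho_eq`)
`σ(u) - ρ(E(u)) = σ_T(u) - ρ(E_T(u)) + ∫_T^u (σ(u - t) - ρ(E_t(u) - 1)) χ(t) / t dt`.
By induction `σ(u - t) ≥ ρ(E(u - t))`, so the integrand is nonnegative as long as
`E(u - t) ≤ E_t(u) - 1`. This holds at `t = u`; let `T` decrease until it fails, or until
`T = u / 2` (`IsKernel.exists_truncation_point`). It remains to bound `σ_T(u)` from below, which, again by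
induction, means to prove that `∫₀ᵀ χ(t) ρ(E_T(u - t)) dt ≥ u ρ(E_T(u))`.

* If `T = u / 2`, only values `E_T(u - t)` with `u - t ≥ T` occur. They are known explicitly, and
  the bound is a rearrangement inequality (`IsKernel.integral_le_integral_mul`): among kernels with
  given `E(T)` the integral against a nondecreasing function is least for `χ = 1_{[0, c]}`.
* If `E(u - T) = E_T(u) - 1`, the rearrangement inequality applies on `[0, u - T]`. On the middle
  interval `[u - T, T]` the function `E` grows by at most `1`, and integrating the derivative of a
  suitable function of `s` and `E(s)` gives a bound (`IsKernel.le_integral_middle`) which turns out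
  to be strictly more than sufficient (`IsKernel.mul_dickmanRho_lt_integral_trunc`).

In the induction the integral equation for `σ_T(u)` involves `σ_T(u - t)` also for small `t`. The
induction therefore proceeds by steps of length `1`, and within a step an error term `c`, which
enters only through `t ∈ [0, 1]`, is halved repeatedly (`IsKernel.dickmanRho_sub_half_le`).

If equality holds and `w > 2`, then the second alternative is excluded, the kernel vanishes on
`[u / 2, u]`, and equality in the rearrangement inequality gives `E(u / w) = 1`.
-/

/-! ### Absolutely continuous functions -/

/-- A locally Lipschitz function is Lipschitz on the compact image of an absolutely continuous
one. -/
theorem LocallyLipschitz.comp_absolutelyContinuousOnInterval {F f : ℝ → ℝ} {p q : ℝ}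
    (hF : LocallyLipschitz F) (hf : AbsolutelyContinuousOnInterval f p q) :
    AbsolutelyContinuousOnInterval (fun x => F (f x)) p q := by
  have hcomp : IsCompact (f '' uIcc p q) := isCompact_uIcc.image_of_continuousOn hf.continuousOn
  obtain ⟨K, hK⟩ :=
    (hF.locallyLipschitzOn (s := f '' uIcc p q)).exists_lipschitzOnWith_of_compact hcomp
  rw [absolutelyContinuousOnInterval_iff] at hf ⊢
  intro ε hε
  obtain ⟨δ, hδ, H⟩ := hf (ε / (K + 1)) (by positivity)
  refine ⟨δ, hδ, fun I hI hlt => ?_⟩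
  have h1 := H I hI hlt
  calc ∑ i ∈ Finset.range I.1, dist (F (f (I.2 i).1)) (F (f (I.2 i).2))
      ≤ ∑ i ∈ Finset.range I.1, (K + 1 : ℝ) * dist (f (I.2 i).1) (f (I.2 i).2) := by
        refine Finset.sum_le_sum fun i hi => ?_
        have h2 := hI.1 i hi
        refine (hK.dist_le_mul _ (mem_image_of_mem f h2.1) _ (mem_image_of_mem f h2.2)).trans ?_
        gcongr
        linarith
    _ = (K + 1) * ∑ i ∈ Finset.range I.1, dist (f (I.2 i).1) (f (I.2 i).2) := by
        rw [Finset.mul_sum]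
    _ < (K + 1) * (ε / (K + 1)) := by gcongr
    _ = ε := by field_simp

/-- The fundamental theorem of calculus for an absolutely continuous function whose derivative is
known almost everywhere. -/
theorem AbsolutelyContinuousOnInterval.intervalIntegrable_and_integral_eq_sub
    {f f' : ℝ → ℝ} {p q : ℝ} (hf : AbsolutelyContinuousOnInterval f p q)
    (hf' : ∀ᵐ x, x ∈ uIcc p q → HasDerivAt f (f' x) x) :
    IntervalIntegrable f' volume p q ∧ ∫ x in p..q, f' x = f q - f p := by
  have hae : ∀ᵐ x, x ∈ uIoc p q → deriv f x = f' x := by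
    filter_upwards [hf'] with x hx hxm using (hx (uIoc_subset_uIcc hxm)).deriv
  refine ⟨?_, ?_⟩
  · exact hf.intervalIntegrable_deriv.congr_ae
      ((ae_restrict_iff' measurableSet_uIoc).2 hae)
  · rw [← hf.integral_deriv_eq_sub]
    exact (intervalIntegral.integral_congr_ae hae).symm

/-! ### Kernels -/

/-- A normalised version of `IsChi`: the kernel is Borel measurable, takes values in `[0, 1]`
everywhere, and equals `1` on the whole half-line `(-∞, 1]`. Every `χ` with `IsChi χ` agrees almost
everywhere on `[0, ∞)` with such a kernel. -/
structure IsKernel (χ : ℝ → ℝ) : Prop where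
  measurable : Measurable χ
  nonneg : ∀ t, 0 ≤ χ t
  le_one : ∀ t, χ t ≤ 1
  eq_one : ∀ t, t ≤ 1 → χ t = 1

/-- The exponent `∫₀ᵘ (1 - χ(t)) / t dt` of `E_χ(u)`. -/
noncomputable def logDefect (χ : ℝ → ℝ) (u : ℝ) : ℝ := ∫ t in (0 : ℝ)..u, (1 - χ t) / t

theorem Echi_eq_exp (χ : ℝ → ℝ) (u : ℝ) : Echi χ u = Real.exp (logDefect χ u) := rfl

theorem Echi_pos (χ : ℝ → ℝ) (u : ℝ) : 0 < Echi χ u := Real.exp_pos _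

theorem log_Echi (χ : ℝ → ℝ) (u : ℝ) : Real.log (Echi χ u) = logDefect χ u := Real.log_exp _

namespace IsKernel

variable {χ : ℝ → ℝ} (hχ : IsKernel χ)

include hχ

theorem defect_nonneg (t : ℝ) : 0 ≤ (1 - χ t) / t := by
  rcases le_or_gt t 1 with h | h
  · simp [hχ.eq_one t h]
  · have := hχ.le_one t
    exact div_nonneg (by linarith) (by linarith)

theorem defect_le_one (t : ℝ) : (1 - χ t) / t ≤ 1 := by
  rcases le_or_gt t 1 with h | h
  · simp [hχ.eq_one t h]
  · rw [div_le_one (by linarith)]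
    linarith [hχ.nonneg t]

theorem defect_le_inv {t : ℝ} (ht : 0 < t) : (1 - χ t) / t ≤ t⁻¹ := by
  rw [div_eq_mul_inv]
  exact mul_le_of_le_one_left (by positivity) (by linarith [hχ.nonneg t])

theorem locallyIntegrable_mul {f : ℝ → ℝ} (hf : Continuous f) :
    LocallyIntegrable (fun t => χ t * f t) volume := by
  refine hf.locallyIntegrable.mono
    (hχ.measurable.aestronglyMeasurable.mul hf.aestronglyMeasurable) (ae_of_all _ fun t => ?_)
  rw [norm_mul, Real.norm_of_nonneg (hχ.nonneg t)]
  exact mul_le_of_le_one_left (norm_nonneg _) (hχ.le_one t)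

theorem intervalIntegrable_mul {f : ℝ → ℝ} (hf : Continuous f) (a b : ℝ) :
    IntervalIntegrable (fun t => χ t * f t) volume a b :=
  ((hχ.locallyIntegrable_mul hf).integrableOn_isCompact isCompact_uIcc).intervalIntegrable

theorem intervalIntegrable (a b : ℝ) : IntervalIntegrable χ volume a b := by
  simpa using hχ.intervalIntegrable_mul (f := fun _ => 1) continuous_const a b

theorem intervalIntegrable_compl_mul {f : ℝ → ℝ} (hf : Continuous f) (a b : ℝ) :
    IntervalIntegrable (fun t => (1 - χ t) * f t) volume a b := by
  have := (hf.intervalIntegrable a b).sub (hχ.intervalIntegrable_mul hf a b)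
  exact this.congr (fun t _ => by ring)

theorem locallyIntegrable_defect : LocallyIntegrable (fun t => (1 - χ t) / t) volume := by
  refine (continuous_const (y := (1 : ℝ))).locallyIntegrable.mono ?_ (ae_of_all _ fun t => ?_)
  · exact ((measurable_const.sub hχ.measurable).div measurable_id).aestronglyMeasurable
  · rw [Real.norm_of_nonneg (hχ.defect_nonneg t)]
    simpa using hχ.defect_le_one t

theorem intervalIntegrable_defect (a b : ℝ) :
    IntervalIntegrable (fun t => (1 - χ t) / t) volume a b :=
  (hχ.locallyIntegrable_defect.integrableOn_isCompact isCompact_uIcc).intervalIntegrable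

theorem logDefect_sub (s t : ℝ) :
    logDefect χ t - logDefect χ s = ∫ x in s..t, (1 - χ x) / x :=
  intervalIntegral.integral_interval_sub_left (hχ.intervalIntegrable_defect _ _)
    (hχ.intervalIntegrable_defect _ _)

theorem monotone_logDefect : Monotone (logDefect χ) := by
  intro s t hst
  have h := hχ.logDefect_sub s t
  have := intervalIntegral.integral_nonneg (μ := volume) hst fun x _ => hχ.defect_nonneg x
  linarith

theorem logDefect_of_le_one {u : ℝ} (hu : u ≤ 1) : logDefect χ u = 0 := by
  have : ∫ t in (0 : ℝ)..u, (1 - χ t) / t = ∫ t in (0 : ℝ)..u, (0 : ℝ) := by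
    refine intervalIntegral.integral_congr fun t ht => ?_
    have h1 : t ≤ 1 := ht.2.trans (max_le zero_le_one hu)
    simp [hχ.eq_one t h1]
  rw [logDefect, this]
  simp

theorem logDefect_nonneg (u : ℝ) : 0 ≤ logDefect χ u := by
  rcases le_total u 0 with h | h
  · rw [hχ.logDefect_of_le_one (h.trans zero_le_one)]
  · have := hχ.monotone_logDefect h
    rwa [hχ.logDefect_of_le_one zero_le_one] at this

theorem logDefect_sub_le {s t : ℝ} (hs : 0 < s) (hst : s ≤ t) :
    logDefect χ t - logDefect χ s ≤ Real.log (t / s) := by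
  have ht : 0 < t := hs.trans_le hst
  rw [hχ.logDefect_sub, ← integral_inv_of_pos hs ht]
  refine intervalIntegral.integral_mono_on hst (hχ.intervalIntegrable_defect _ _) ?_ ?_
  · exact intervalIntegral.intervalIntegrable_inv (fun x hx => by
      rw [uIcc_of_le hst] at hx
      linarith [hx.1]) continuousOn_id
  · intro x hx
    exact hχ.defect_le_inv (hs.trans_le hx.1)

theorem absolutelyContinuousOnInterval_logDefect (p q : ℝ) :
    AbsolutelyContinuousOnInterval (logDefect χ) p q := by
  have h := (hχ.intervalIntegrable_defect p q).absolutelyContinuousOnInterval_intervalIntegral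
    (c := p) left_mem_uIcc
  have h2 : AbsolutelyContinuousOnInterval (fun _ : ℝ => logDefect χ p) p q :=
    (LipschitzWith.const _).lipschitzOnWith.absolutelyContinuousOnInterval
  convert! h2.add h using 1
  funext x
  have := hχ.logDefect_sub p x
  simp only [Pi.add_apply]
  linarith

theorem ae_hasDerivAt_logDefect :
    ∀ᵐ x, HasDerivAt (logDefect χ) ((1 - χ x) / x) x := by
  filter_upwards [_root_.LocallyIntegrable.ae_hasDerivAt_integral hχ.locallyIntegrable_defect]
    with x hx
  exact hx 0

theorem continuous_logDefect : Continuous (logDefect χ) :=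
  intervalIntegral.continuous_primitive (fun a b => hχ.intervalIntegrable_defect a b) 0

theorem continuous_Echi : Continuous (Echi χ) :=
  Real.continuous_exp.comp hχ.continuous_logDefect

theorem monotone_Echi : Monotone (Echi χ) :=
  Real.exp_monotone.comp hχ.monotone_logDefect

theorem one_le_Echi (u : ℝ) : 1 ≤ Echi χ u := Real.one_le_exp (hχ.logDefect_nonneg u)

theorem Echi_of_le_one {u : ℝ} (hu : u ≤ 1) : Echi χ u = 1 := by
  rw [Echi_eq_exp, hχ.logDefect_of_le_one hu, Real.exp_zero]

/-- `E(t) / t` is nonincreasing. -/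
theorem Echi_mul_le {s t : ℝ} (hs : 0 < s) (hst : s ≤ t) : Echi χ t * s ≤ Echi χ s * t := by
  have h := hχ.logDefect_sub_le hs hst
  have h2 : Echi χ t ≤ Echi χ s * (t / s) := by
    rw [← Real.exp_log (div_pos (hs.trans_le hst) hs), Echi_eq_exp, Echi_eq_exp, ← Real.exp_add]
    exact Real.exp_le_exp.2 (by linarith)
  calc Echi χ t * s ≤ Echi χ s * (t / s) * s := by gcongr
    _ = Echi χ s * t := by field_simp

theorem absolutelyContinuousOnInterval_Echi (p q : ℝ) :
    AbsolutelyContinuousOnInterval (Echi χ) p q :=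
  (Real.contDiff_exp (n := 1)).locallyLipschitz.comp_absolutelyContinuousOnInterval
    (hχ.absolutelyContinuousOnInterval_logDefect p q)

theorem ae_hasDerivAt_Echi :
    ∀ᵐ x, HasDerivAt (Echi χ) (Echi χ x * ((1 - χ x) / x)) x := by
  filter_upwards [hχ.ae_hasDerivAt_logDefect] with x hx using hx.exp

/-- Minimum principle: if `v h(v)` dominates the `χ`-weighted integral of `h` over `[0, v]`, then
`h` inherits nonnegativity from `[0, 1]`. At a negative minimum `v`, the stretch of length `1` where
`h ≥ 0` makes the weighted integral at least `(v - 1) h(v)`, which exceeds `v h(v)`. -/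
theorem nonneg_of_integral_le {h : ℝ → ℝ} {X : ℝ} (hh : Continuous h)
    (h0 : ∀ v, 0 ≤ v → v ≤ 1 → 0 ≤ h v)
    (hstep : ∀ v, 1 < v → v ≤ X → ∫ t in (0 : ℝ)..v, χ t * h (v - t) ≤ v * h v)
    {v : ℝ} (hv0 : 0 ≤ v) (hvX : v ≤ X) : 0 ≤ h v := by
  obtain ⟨m, hm, hmin⟩ := isCompact_Icc.exists_isMinOn (nonempty_Icc.2 (hv0.trans hvX))
    hh.continuousOn
  refine le_trans ?_ (hmin ⟨hv0, hvX⟩)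
  by_contra! hneg
  have hm1 : 1 < m := by
    by_contra! h1
    exact absurd (h0 m hm.1 h1) (not_le.2 hneg)
  have hcont : Continuous fun t => h (m - t) := by fun_prop
  have hi := fun a b => hχ.intervalIntegrable_mul hcont a b
  have h1 : ∫ _t in (0 : ℝ)..(m - 1), h m ≤ ∫ t in (0 : ℝ)..(m - 1), χ t * h (m - t) := by
    refine intervalIntegral.integral_mono_on (by linarith) (by simp) (hi _ _) fun t ht => ?_
    have h2 : h m ≤ h (m - t) := hmin ⟨by linarith [ht.2], by linarith [ht.1, hm.2]⟩
    calc h m ≤ χ t * h m := by nlinarith [hχ.le_one t]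
      _ ≤ χ t * h (m - t) := mul_le_mul_of_nonneg_left h2 (hχ.nonneg t)
  have h2 : 0 ≤ ∫ t in (m - 1)..m, χ t * h (m - t) := by
    refine intervalIntegral.integral_nonneg (by linarith) fun t ht => ?_
    exact mul_nonneg (hχ.nonneg t) (h0 _ (by linarith [ht.2]) (by linarith [ht.1]))
  have h3 := intervalIntegral.integral_add_adjacent_intervals (hi 0 (m - 1)) (hi (m - 1) m)
  have h4 := hstep m hm1 hm.2
  simp only [intervalIntegral.integral_const, sub_zero, smul_eq_mul] at h1
  linarith

end IsKernel

/-- `σ` solves the integral equation with kernel `χ` up to the point `X`; it is normalised to be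
continuous on all of `ℝ` and to equal `1` on `(-∞, 1]`. -/
structure SolvesUpTo (χ σ : ℝ → ℝ) (X : ℝ) : Prop where
  continuous : Continuous σ
  eq_one : ∀ u, u ≤ 1 → σ u = 1
  integral_eq : ∀ u, 1 < u → u ≤ X → u * σ u = ∫ t in (0 : ℝ)..u, χ t * σ (u - t)

theorem SolvesUpTo.mono {χ σ : ℝ → ℝ} {X Y : ℝ} (hσ : SolvesUpTo χ σ X) (hY : Y ≤ X) :
    SolvesUpTo χ σ Y :=
  ⟨hσ.continuous, hσ.eq_one, fun u h1 h2 => hσ.integral_eq u h1 (h2.trans hY)⟩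

theorem SolvesUpTo.nonneg {χ σ : ℝ → ℝ} {X : ℝ} (hχ : IsKernel χ) (hσ : SolvesUpTo χ σ X) {v : ℝ}
    (hv : v ≤ X) : 0 ≤ σ v := by
  rcases le_or_gt v 1 with h | h
  · rw [hσ.eq_one v h]
    exact zero_le_one
  · refine hχ.nonneg_of_integral_le (X := X) hσ.continuous ?_ ?_ (by linarith) hv
    · intro v _ hv1
      rw [hσ.eq_one v hv1]
      exact zero_le_one
    · intro v hv1 hv2
      exact (hσ.integral_eq v hv1 hv2).ge

/-! ### The Dickman function -/

theorem hasDerivAt_integral_dickmanRho (c x : ℝ) :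
    HasDerivAt (fun x => ∫ t in c..x, dickmanRho t) (dickmanRho x) x :=
  intervalIntegral.integral_hasDerivAt_right (continuous_dickmanRho.intervalIntegrable _ _)
    continuous_dickmanRho.stronglyMeasurable.stronglyMeasurableAtFilter
    continuous_dickmanRho.continuousAt

theorem integral_dickmanRho_sub (a b c : ℝ) :
    (∫ t in c..b, dickmanRho t) - ∫ t in c..a, dickmanRho t = ∫ t in a..b, dickmanRho t :=
  intervalIntegral.integral_interval_sub_left (continuous_dickmanRho.intervalIntegrable _ _)
    (continuous_dickmanRho.intervalIntegrable _ _)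

/-- The integral form `x ρ(x) = ∫_{x-1}^x ρ` of the delay differential equation. -/
theorem mul_dickmanRho {x : ℝ} (hx : 1 ≤ x) :
    x * dickmanRho x = ∫ t in (x - 1)..x, dickmanRho t := by
  set R : ℝ → ℝ := fun x => ∫ t in (0 : ℝ)..x, dickmanRho t with hR
  set F : ℝ → ℝ := fun x => x * dickmanRho x - (R x - R (x - 1)) with hF
  have hR' : ∀ x, HasDerivAt R (dickmanRho x) x := hasDerivAt_integral_dickmanRho 0
  have hRc : Continuous R := continuous_iff_continuousAt.2 fun x => (hR' x).continuousAt
  have hFc : Continuous F := by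
    have := continuous_dickmanRho
    fun_prop
  have h1 : F 1 = 0 := by
    have : R 1 = 1 := by
      have : R 1 = ∫ t in (0 : ℝ)..1, (1 : ℝ) := intervalIntegral.integral_congr fun t ht =>
        dickmanRho_of_le_one (by simpa using ht.2)
      simpa using this
    simp [hF, this, dickmanRho_of_le_one le_rfl]
    simp [hR]
  have hF' : ∀ y, 1 < y → HasDerivAt F 0 y := by
    intro y hy
    have h2 : HasDerivAt (fun x => R (x - 1)) (dickmanRho (y - 1)) y := by
      simpa using (hR' (y - 1)).comp_sub_const y 1
    have h3 := ((hasDerivAt_id y).mul (hasDerivAt_dickmanRho hy)).sub ((hR' y).sub h2)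
    convert! h3 using 1
    simp only [id]
    field_simp
    ring
  have key : F x = 0 := by
    rcases hx.eq_or_lt with rfl | hx
    · exact h1
    · obtain ⟨c, hc, hc'⟩ := exists_hasDerivAt_eq_slope F (fun _ => 0) hx hFc.continuousOn
        fun y hy => hF' y hy.1
      rw [h1, sub_zero, eq_comm, div_eq_zero_iff] at hc'
      rcases hc' with h | h
      · exact h
      · linarith
  have h2 := integral_dickmanRho_sub (x - 1) x 0
  simp only [hF, hR] at key
  linarith

/-- The kernel of the Dickman function. -/
theorem isKernel_indicator : IsKernel (fun t : ℝ => if t ≤ 1 then 1 else 0) where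
  measurable := Measurable.ite measurableSet_Iic measurable_const measurable_const
  nonneg t := by split_ifs <;> norm_num
  le_one t := by split_ifs <;> norm_num
  eq_one t ht := if_pos ht

theorem integral_indicator_mul_dickmanRho {u : ℝ} (hu : 1 < u) :
    ∫ t in (0 : ℝ)..u, (if t ≤ 1 then (1 : ℝ) else 0) * dickmanRho (u - t) = u * dickmanRho u := by
  have hc : Continuous fun t => dickmanRho (u - t) := continuous_dickmanRho.comp (by fun_prop)
  rw [← intervalIntegral.integral_add_adjacent_intervals
    (isKernel_indicator.intervalIntegrable_mul hc 0 1)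
    (isKernel_indicator.intervalIntegrable_mul hc 1 u)]
  have h1 : ∫ t in (0 : ℝ)..1, (if t ≤ 1 then (1 : ℝ) else 0) * dickmanRho (u - t)
      = ∫ t in (0 : ℝ)..1, dickmanRho (u - t) := by
    refine intervalIntegral.integral_congr fun t ht => ?_
    rw [uIcc_of_le zero_le_one] at ht
    simp [ht.2]
  have h2 : ∫ t in (1 : ℝ)..u, (if t ≤ 1 then (1 : ℝ) else 0) * dickmanRho (u - t) = 0 := by
    refine intervalIntegral.integral_zero_ae (ae_of_all _ fun t ht => ?_)
    rw [uIoc_of_le hu.le] at ht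
    simp [not_le.2 ht.1]
  rw [h1, h2, add_zero, intervalIntegral.integral_comp_sub_left (fun t => dickmanRho t), sub_zero,
    mul_dickmanRho hu.le]

theorem solvesUpTo_dickmanRho (X : ℝ) :
    SolvesUpTo (fun t : ℝ => if t ≤ 1 then 1 else 0) dickmanRho X :=
  ⟨continuous_dickmanRho, fun _ => dickmanRho_of_le_one,
    fun _ hu _ => (integral_indicator_mul_dickmanRho hu).symm⟩

theorem dickmanRho_nonneg (w : ℝ) : 0 ≤ dickmanRho w :=
  (solvesUpTo_dickmanRho w).nonneg isKernel_indicator le_rfl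

theorem antitone_dickmanRho : Antitone dickmanRho := by
  have h : AntitoneOn dickmanRho (Ici 1) := by
    refine antitoneOn_of_deriv_nonpos (convex_Ici 1) continuous_dickmanRho.continuousOn ?_ ?_
    · intro x hx
      rw [interior_Ici] at hx
      exact (hasDerivAt_dickmanRho hx).differentiableAt.differentiableWithinAt
    · intro x hx
      rw [interior_Ici] at hx
      rw [(hasDerivAt_dickmanRho hx).deriv, neg_nonpos]
      exact div_nonneg (dickmanRho_nonneg _) (zero_le_one.trans hx.le)
  have h1 : ∀ x, dickmanRho x = dickmanRho (max 1 x) := by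
    intro x
    rcases le_total x 1 with hx | hx
    · rw [max_eq_left hx, dickmanRho_of_le_one hx, dickmanRho_of_le_one le_rfl]
    · rw [max_eq_right hx]
  intro x y hxy
  rw [h1 x, h1 y]
  exact h (le_max_left 1 x) (le_max_left 1 y) (max_le_max_left 1 hxy)

theorem dickmanRho_le_one (w : ℝ) : dickmanRho w ≤ 1 := by
  have h := antitone_dickmanRho (min_le_left w 1)
  rwa [dickmanRho_of_le_one (min_le_right w 1)] at h

theorem dickmanRho_pos (w : ℝ) : 0 < dickmanRho w := by
  obtain ⟨n, hn⟩ := exists_nat_ge w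
  induction n generalizing w with
  | zero =>
    rw [dickmanRho_of_le_one (hn.trans (by simp))]
    exact one_pos
  | succ n ih =>
    rcases le_or_gt w 1 with h | h
    · rw [dickmanRho_of_le_one h]
      exact one_pos
    -- a zero at `w` would be a zero of the integral of `ρ` over `[w - 1, w]`, and `ρ(w - 1) > 0`
    rw [← mul_pos_iff_of_pos_left (zero_lt_one.trans h), mul_dickmanRho h.le]
    push_cast at hn
    exact intervalIntegral.integral_pos (by linarith) continuous_dickmanRho.continuousOn
      (fun x _ => dickmanRho_nonneg x) ⟨w - 1, by simp, ih _ (by linarith)⟩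

theorem strictAntiOn_dickmanRho : StrictAntiOn dickmanRho (Ici 1) := by
  refine strictAntiOn_of_deriv_neg (convex_Ici 1) continuous_dickmanRho.continuousOn ?_
  intro x hx
  rw [interior_Ici] at hx
  rw [(hasDerivAt_dickmanRho hx).deriv, neg_lt_zero]
  exact div_pos (dickmanRho_pos _) (zero_lt_one.trans hx)

theorem lipschitzWith_dickmanRho : LipschitzWith 1 dickmanRho := by
  have hmono : MonotoneOn (fun x => dickmanRho x + x) (Ici 1) := by
    refine monotoneOn_of_deriv_nonneg (convex_Ici 1)
      (continuous_dickmanRho.add continuous_id).continuousOn ?_ ?_ <;> intro x hx <;>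
      rw [interior_Ici] at hx
    · exact ((hasDerivAt_dickmanRho hx).add
        (hasDerivAt_id' x)).differentiableAt.differentiableWithinAt
    · have hx1 : 1 < x := hx
      have h : HasDerivAt (fun x => dickmanRho x + x) (-(dickmanRho (x - 1) / x) + 1) x :=
        (hasDerivAt_dickmanRho hx).add (hasDerivAt_id' x)
      rw [h.deriv]
      have : dickmanRho (x - 1) / x ≤ 1 := by
        rw [div_le_one (by linarith)]
        linarith [dickmanRho_le_one (x - 1)]
      linarith
  have h1 : ∀ x, dickmanRho x = dickmanRho (max 1 x) := by
    intro x
    rcases le_total x 1 with hx | hx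
    · rw [max_eq_left hx, dickmanRho_of_le_one hx, dickmanRho_of_le_one le_rfl]
    · rw [max_eq_right hx]
  refine LipschitzWith.of_le_add fun x y => ?_
  rcases le_total y x with hxy | hxy
  · linarith [antitone_dickmanRho hxy, dist_nonneg (x := x) (y := y)]
  · rw [h1 x, h1 y]
    have h2 := hmono (le_max_left 1 x) (le_max_left 1 y) (max_le_max_left 1 hxy)
    have h3 : max 1 y - max 1 x ≤ y - x := by
      rcases le_total 1 x with h | h <;> rcases le_total 1 y with h' | h' <;> simp [h, h'] <;>
        linarith
    rw [Real.dist_eq, abs_sub_comm, abs_of_nonneg (by linarith)]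
    simp only at h2
    linarith

theorem dickmanRho_eq_one_sub_log {w : ℝ} (h1 : 1 ≤ w) (h2 : w ≤ 2) :
    dickmanRho w = 1 - Real.log w := by
  rcases h1.eq_or_lt with rfl | h1
  · simp [dickmanRho_of_le_one]
  obtain ⟨c, hc, hc'⟩ := exists_hasDerivAt_eq_slope (fun x => dickmanRho x + Real.log x)
    (fun _ => 0) h1
    (continuous_dickmanRho.continuousOn.add
      (Real.continuousOn_log.mono fun x hx => by
        have : (1 : ℝ) ≤ x := hx.1
        simp only [mem_compl_iff, mem_singleton_iff]
        linarith))
    fun y hy => by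
      have h := (hasDerivAt_dickmanRho hy.1).add (Real.hasDerivAt_log (x := y) (by linarith [hy.1]))
      rw [dickmanRho_of_le_one (w := y - 1) (by linarith [hy.2])] at h
      convert! h using 1
      ring
  rw [eq_comm, div_eq_zero_iff] at hc'
  simp only [Real.log_one, dickmanRho_of_le_one le_rfl] at hc'
  rcases hc' with h | h <;> linarith

/-! ### The range `E ≤ 2` -/

namespace IsKernel

variable {χ : ℝ → ℝ} (hχ : IsKernel χ)

include hχ

/-- Integration by parts for `u log E(u)`. -/
theorem integral_compl (u : ℝ) :
    ∫ t in (0 : ℝ)..u, (1 - χ t) = u * logDefect χ u - ∫ t in (0 : ℝ)..u, logDefect χ t := by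
  have hid : AbsolutelyContinuousOnInterval (fun x : ℝ => x) 0 u :=
    LipschitzWith.id.lipschitzOnWith.absolutelyContinuousOnInterval
  have h := (hid.fun_mul
    (hχ.absolutelyContinuousOnInterval_logDefect 0 u)).intervalIntegrable_and_integral_eq_sub
    (f' := fun x => logDefect χ x + (1 - χ x)) (by
      filter_upwards [hχ.ae_hasDerivAt_logDefect] with x hx _
      convert! (hasDerivAt_id' x).mul hx using 1
      rcases eq_or_ne x 0 with rfl | h0
      · simp [hχ.eq_one 0 zero_le_one]
      · field_simp)
  have h2 := h.2
  rw [intervalIntegral.integral_add (hχ.continuous_logDefect.intervalIntegrable _ _)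
    (by simpa using hχ.intervalIntegrable_compl_mul (f := fun _ => 1) continuous_const 0 u)] at h2
  linarith

/-- The function `1 - log E` satisfies the integral equation for `σ` up to a nonnegative term. -/
theorem integral_mul_one_sub_logDefect (v : ℝ) :
    ∫ t in (0 : ℝ)..v, χ t * (1 - logDefect χ (v - t))
      = v * (1 - logDefect χ v) + ∫ t in (0 : ℝ)..v, (1 - χ t) * logDefect χ (v - t) := by
  have hc : Continuous fun t => logDefect χ (v - t) :=
    hχ.continuous_logDefect.comp (by fun_prop)
  have h1 : ∀ t, χ t * (1 - logDefect χ (v - t))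
      = (1 - logDefect χ (v - t)) - (1 - χ t) + (1 - χ t) * logDefect χ (v - t) := fun t => by ring
  have hi : IntervalIntegrable (fun t => 1 - χ t) volume 0 v := by
    simpa using hχ.intervalIntegrable_compl_mul (f := fun _ => 1) continuous_const 0 v
  have hi2 : IntervalIntegrable (fun t => 1 - logDefect χ (v - t)) volume 0 v :=
    (continuous_const.sub hc).intervalIntegrable _ _
  simp_rw [h1]
  rw [intervalIntegral.integral_add (hi2.sub hi) (hχ.intervalIntegrable_compl_mul hc 0 v),
    intervalIntegral.integral_sub hi2 hi, hχ.integral_compl,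
    intervalIntegral.integral_sub (by simp) (hc.intervalIntegrable _ _),
    intervalIntegral.integral_comp_sub_left (fun t => logDefect χ t)]
  simp
  ring

theorem integral_compl_mul_logDefect_nonneg {v : ℝ} (hv : 0 ≤ v) :
    0 ≤ ∫ t in (0 : ℝ)..v, (1 - χ t) * logDefect χ (v - t) :=
  intervalIntegral.integral_nonneg hv fun t _ =>
    mul_nonneg (by linarith [hχ.le_one t]) (hχ.logDefect_nonneg _)

/-- The inclusion-exclusion lower bound `σ(v) ≥ 1 - log E(v)`. -/
theorem one_sub_logDefect_le {σ : ℝ → ℝ} {X v : ℝ} (hσ : SolvesUpTo χ σ X) (hv : v ≤ X) :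
    1 - logDefect χ v ≤ σ v := by
  rcases le_or_gt v 1 with h1 | h1
  · rw [hσ.eq_one v h1, hχ.logDefect_of_le_one h1, sub_zero]
  have hc := hχ.continuous_logDefect
  have hs := hσ.continuous
  have key : 0 ≤ σ v - (1 - logDefect χ v) := by
    refine hχ.nonneg_of_integral_le (h := fun v => σ v - (1 - logDefect χ v)) (X := X)
      (by fun_prop) ?_ ?_ (by linarith) hv
    · intro v _ hv
      rw [hσ.eq_one v hv, hχ.logDefect_of_le_one hv]
      simp
    · intro v hv1 hv2
      have h2 := hσ.integral_eq v hv1 hv2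
      have h3 := hχ.integral_mul_one_sub_logDefect v
      have h4 := hχ.integral_compl_mul_logDefect_nonneg (v := v) (by linarith)
      have h5 : ∫ t in (0 : ℝ)..v, χ t * (σ (v - t) - (1 - logDefect χ (v - t)))
          = (∫ t in (0 : ℝ)..v, χ t * σ (v - t))
            - ∫ t in (0 : ℝ)..v, χ t * (1 - logDefect χ (v - t)) := by
        rw [← intervalIntegral.integral_sub
          (hχ.intervalIntegrable_mul (f := fun t => σ (v - t)) (by fun_prop) _ _)
          (hχ.intervalIntegrable_mul (f := fun t => 1 - logDefect χ (v - t)) (by fun_prop) _ _)]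
        exact intervalIntegral.integral_congr fun t _ => by ring
      rw [h5]
      linarith
  linarith

/-- Equality in `one_sub_logDefect_le` forces `E(u / 2) = 1`. -/
theorem logDefect_half_eq_zero {σ : ℝ → ℝ} {X u : ℝ} (hσ : SolvesUpTo χ σ X) (hu : u ≤ X)
    (heq : σ u = 1 - logDefect χ u) : logDefect χ (u / 2) = 0 := by
  rcases le_or_gt u 1 with h1 | h1
  · exact hχ.logDefect_of_le_one (by linarith)
  have hc : Continuous fun t => logDefect χ (u - t) :=
    hχ.continuous_logDefect.comp (by fun_prop)
  have hs : Continuous fun t => σ (u - t) := hσ.continuous.comp (by fun_prop)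
  have hi := fun a b => hχ.intervalIntegrable_compl_mul hc a b
  have h2 : ∫ t in (0 : ℝ)..u, χ t * (1 - logDefect χ (u - t))
      ≤ ∫ t in (0 : ℝ)..u, χ t * σ (u - t) := by
    refine intervalIntegral.integral_mono_on (by linarith)
      (hχ.intervalIntegrable_mul (continuous_const.sub hc) _ _)
      (hχ.intervalIntegrable_mul hs _ _) fun t ht => ?_
    exact mul_le_mul_of_nonneg_left
      (hχ.one_sub_logDefect_le hσ (by linarith [ht.1])) (hχ.nonneg t)
  rw [← hσ.integral_eq u h1 hu, hχ.integral_mul_one_sub_logDefect, heq] at h2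
  -- the second half of `∫₀ᵘ (1 - χ(t)) log E(u - t) dt` is nonnegative, and on the first half
  -- `log E(u - t) ≥ log E(u / 2)` and `1 - χ(t) ≥ (1 - χ(t)) / t`
  have h3 : logDefect χ (u / 2) * logDefect χ (u / 2)
      ≤ ∫ t in (0 : ℝ)..(u / 2), (1 - χ t) * logDefect χ (u - t) := by
    rw [show logDefect χ (u / 2) * logDefect χ (u / 2)
      = ∫ t in (0 : ℝ)..(u / 2), logDefect χ (u / 2) * ((1 - χ t) / t) by
        rw [intervalIntegral.integral_const_mul]; rfl]
    refine intervalIntegral.integral_mono_on (by linarith)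
      ((hχ.intervalIntegrable_defect _ _).const_mul _) (hi _ _) fun t ht => ?_
    have h4 : (1 - χ t) / t ≤ 1 - χ t := by
      rcases le_or_gt t 1 with h | h
      · simp [hχ.eq_one t h]
      · exact div_le_self (by linarith [hχ.le_one t]) h.le
    have h5 := hχ.monotone_logDefect (show u / 2 ≤ u - t by linarith [ht.2])
    rw [mul_comm]
    exact mul_le_mul h4 h5 (hχ.logDefect_nonneg _) (by linarith [hχ.le_one t])
  have h4 : 0 ≤ ∫ t in (u / 2)..u, (1 - χ t) * logDefect χ (u - t) :=
    intervalIntegral.integral_nonneg (by linarith) fun t _ =>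
      mul_nonneg (by linarith [hχ.le_one t]) (hχ.logDefect_nonneg _)
  have h5 := intervalIntegral.integral_add_adjacent_intervals (hi 0 (u / 2)) (hi (u / 2) u)
  nlinarith [hχ.logDefect_nonneg (u / 2)]

end IsKernel

/-! ### Truncated kernels -/

/-- The kernel `χ` with its values on `(T, ∞)` replaced by `0`. -/
noncomputable def truncKernel (χ : ℝ → ℝ) (T t : ℝ) : ℝ := if t ≤ T then χ t else 0

/-- The solution for the kernel `truncKernel χ T`, expressed through the solution `σ` for `χ`. The
formula is the first-order one, and it is exact only on `[0, 2 T]`. -/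
noncomputable def truncSol (χ σ : ℝ → ℝ) (T v : ℝ) : ℝ :=
  σ v - ∫ t in T..(max T v), χ t / t * σ (v - t)

theorem truncKernel_of_le {χ : ℝ → ℝ} {T t : ℝ} (h : t ≤ T) : truncKernel χ T t = χ t := if_pos h

theorem truncKernel_of_lt {χ : ℝ → ℝ} {T t : ℝ} (h : T < t) : truncKernel χ T t = 0 :=
  if_neg (not_le.2 h)

theorem truncSol_of_le {χ σ : ℝ → ℝ} {T v : ℝ} (h : v ≤ T) : truncSol χ σ T v = σ v := by
  simp [truncSol, max_eq_left h]

theorem truncSol_of_ge {χ σ : ℝ → ℝ} {T v : ℝ} (h : T ≤ v) :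
    truncSol χ σ T v = σ v - ∫ t in T..v, χ t / t * σ (v - t) := by
  rw [truncSol, max_eq_right h]

theorem logDefect_trunc_of_le {χ : ℝ → ℝ} {T v : ℝ} (hT : 1 ≤ T) (hv : v ≤ T) :
    logDefect (truncKernel χ T) v = logDefect χ v := by
  refine intervalIntegral.integral_congr fun t ht => ?_
  have : t ≤ T := ht.2.trans (max_le (by linarith) hv)
  simp only [truncKernel_of_le this]

theorem Echi_trunc_of_le {χ : ℝ → ℝ} {T v : ℝ} (hT : 1 ≤ T) (hv : v ≤ T) :
    Echi (truncKernel χ T) v = Echi χ v := by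
  rw [Echi_eq_exp, Echi_eq_exp, logDefect_trunc_of_le hT hv]

namespace IsKernel

variable {χ : ℝ → ℝ} (hχ : IsKernel χ)

include hχ

theorem trunc {T : ℝ} (hT : 1 ≤ T) : IsKernel (truncKernel χ T) where
  measurable := Measurable.ite measurableSet_Iic hχ.measurable measurable_const
  nonneg t := by
    unfold truncKernel
    split_ifs
    exacts [hχ.nonneg t, le_rfl]
  le_one t := by
    unfold truncKernel
    split_ifs
    exacts [hχ.le_one t, zero_le_one]
  eq_one t ht := by rw [truncKernel_of_le (ht.trans hT), hχ.eq_one t ht]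

theorem Echi_trunc_of_ge {T v : ℝ} (hT : 1 ≤ T) (hv : T ≤ v) :
    Echi (truncKernel χ T) v = Echi χ T / T * v := by
  have hT0 : 0 < T := by linarith
  have h1 := (hχ.trunc hT).logDefect_sub T v
  have h2 : ∫ x in T..v, (1 - truncKernel χ T x) / x = Real.log (v / T) := by
    rw [← integral_inv_of_pos hT0 (hT0.trans_le hv)]
    refine intervalIntegral.integral_congr_ae (ae_of_all _ fun x hx => ?_)
    rw [uIoc_of_le hv] at hx
    rw [truncKernel_of_lt hx.1, sub_zero, one_div]
  rw [h2, logDefect_trunc_of_le hT le_rfl] at h1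
  rw [Echi_eq_exp, Echi_eq_exp, show logDefect (truncKernel χ T) v
    = logDefect χ T + Real.log (v / T) by linarith, Real.exp_add,
    Real.exp_log (div_pos (hT0.trans_le hv) hT0)]
  ring

theorem locallyIntegrable_div_max : LocallyIntegrable (fun t => χ t / max 1 t) volume := by
  have h : Continuous fun t : ℝ => (max 1 t)⁻¹ :=
    Continuous.inv₀ (by fun_prop) fun t => (zero_lt_one.trans_le (le_max_left 1 t)).ne'
  simpa only [div_eq_mul_inv] using hχ.locallyIntegrable_mul h

theorem intervalIntegrable_div_mul {f : ℝ → ℝ} (hf : Continuous f) {p q : ℝ} (hp : 1 ≤ p)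
    (hpq : p ≤ q) : IntervalIntegrable (fun t => χ t / t * f t) volume p q := by
  have h : Continuous fun t : ℝ => (max 1 t)⁻¹ * f t :=
    (Continuous.inv₀ (by fun_prop) fun t => (zero_lt_one.trans_le (le_max_left 1 t)).ne').mul hf
  refine (hχ.intervalIntegrable_mul h p q).congr fun t ht => ?_
  rw [uIoc_of_le hpq] at ht
  simp only [max_eq_right (hp.trans ht.1.le)]
  ring

end IsKernel

theorem continuous_integral_mul_comp_sub {k f : ℝ → ℝ} (hk : LocallyIntegrable k volume)
    (hf : Continuous f) (p q : ℝ) : Continuous fun v => ∫ t in p..q, k t * f (v - t) := by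
  rw [continuous_iff_continuousAt]
  intro v₀
  have hki : IntervalIntegrable k volume p q :=
    (hk.integrableOn_isCompact isCompact_uIcc).intervalIntegrable
  set S : Set ℝ := (fun z : ℝ × ℝ => z.1 - z.2) '' (Icc (v₀ - 1) (v₀ + 1) ×ˢ uIcc p q) with hS
  have hSc : IsCompact S :=
    (isCompact_Icc.prod isCompact_uIcc).image (continuous_fst.sub continuous_snd)
  obtain ⟨M, hM⟩ := hSc.exists_bound_of_continuousOn hf.continuousOn
  refine intervalIntegral.continuousAt_of_dominated_interval (bound := fun t => ‖k t‖ * M)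
    (.of_forall fun v => hki.aestronglyMeasurable_restrict_uIoc.mul
      (hf.comp (by fun_prop)).aestronglyMeasurable) ?_ (hki.norm.mul_const M) ?_
  · filter_upwards [Icc_mem_nhds (show v₀ - 1 < v₀ by linarith) (show v₀ < v₀ + 1 by linarith)]
      with v hv
    refine ae_of_all _ fun t ht => ?_
    rw [norm_mul]
    exact mul_le_mul_of_nonneg_left
      (hM _ ⟨(v, t), ⟨hv, uIoc_subset_uIcc ht⟩, rfl⟩) (norm_nonneg _)
  · exact ae_of_all _ fun t _ => by fun_prop

theorem SolvesUpTo.continuous_truncSol {χ σ : ℝ → ℝ} {X T : ℝ} (hχ : IsKernel χ)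
    (hσ : SolvesUpTo χ σ X) (hT : 1 ≤ T) : Continuous (truncSol χ σ T) := by
  refine hσ.continuous.sub ?_
  have hk := hχ.locallyIntegrable_div_max
  have hki : ∀ a b, IntervalIntegrable (fun t => χ t / max 1 t) volume a b := fun a b =>
    (hk.integrableOn_isCompact isCompact_uIcc).intervalIntegrable
  have hs := hσ.continuous
  have hki2 : ∀ v a b, IntervalIntegrable (fun t => χ t / max 1 t * (σ (v - t) - 1)) volume a b :=
    fun v a b => (hki a b).mul_continuousOn (by fun_prop)
  rw [continuous_iff_continuousAt]
  intro v₀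
  set C := max T v₀ + 1
  -- `σ - 1` vanishes on negative arguments, so its integral may be extended to a fixed endpoint
  have heq : (fun v => ∫ t in T..(max T v), χ t / t * σ (v - t)) =ᶠ[nhds v₀]
      fun v => (∫ t in T..(max T v), χ t / max 1 t)
        + ∫ t in T..C, χ t / max 1 t * (σ (v - t) - 1) := by
    filter_upwards [Iio_mem_nhds (show v₀ < v₀ + 1 by linarith)] with v hv
    have hvC : max T v ≤ C := by
      have hv' : v < v₀ + 1 := hv
      refine max_le ?_ ?_
      · linarith [le_max_left T v₀]
      · linarith [le_max_right T v₀]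
    have h0 : ∫ t in (max T v)..C, χ t / max 1 t * (σ (v - t) - 1) = 0 := by
      refine intervalIntegral.integral_zero_ae (ae_of_all _ fun t ht => ?_)
      rw [uIoc_of_le hvC] at ht
      rw [hσ.eq_one _ (by linarith [ht.1, le_max_right T v]), sub_self, mul_zero]
    rw [← intervalIntegral.integral_add_adjacent_intervals (hki2 v T (max T v)) (hki2 v _ C), h0,
      add_zero, ← intervalIntegral.integral_add (hki _ _) (hki2 _ _ _)]
    refine intervalIntegral.integral_congr fun t ht => ?_
    rw [uIcc_of_le (le_max_left T v)] at ht
    simp only [max_eq_right (hT.trans ht.1)]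
    ring
  refine ContinuousAt.congr ?_ heq.symm
  have hc1 : Continuous fun v => ∫ t in T..(max T v), χ t / max 1 t :=
    (intervalIntegral.continuous_primitive hki T).comp (by fun_prop)
  exact (hc1.add (continuous_integral_mul_comp_sub hk (f := fun x => σ x - 1)
    (by fun_prop) T C)).continuousAt

/-- Fubini's theorem on the triangle `{(t, s) | 0 < t, T < s, s + t ≤ v}`. -/
theorem integral_integral_triangle_swap {f : ℝ → ℝ → ℝ} {T v M : ℝ} (hTv : T ≤ v)
    (hf : Measurable (Function.uncurry f))
    (hM : ∀ t s, 0 < t → T < s → s + t ≤ v → ‖f t s‖ ≤ M) :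
    ∫ t in (0 : ℝ)..(v - T), ∫ s in T..(v - t), f t s
      = ∫ s in T..v, ∫ t in (0 : ℝ)..(v - s), f t s := by
  set A : Set (ℝ × ℝ) := {z | z.2 + z.1 ≤ v} with hA
  have hAm : MeasurableSet A := measurableSet_le (by fun_prop) measurable_const
  set F : ℝ → ℝ → ℝ := fun t s => A.indicator (Function.uncurry f) (t, s) with hF
  have hFm : Measurable (Function.uncurry F) := hf.indicator hAm
  have hFi : Integrable (Function.uncurry F)
      ((volume.restrict (Ioc 0 (v - T))).prod (volume.restrict (Ioc T v))) := by
    rw [Measure.prod_restrict]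
    refine Measure.integrableOn_of_bounded (M := M) ?_ hFm.aestronglyMeasurable ?_
    · rw [Measure.prod_prod]
      simp [ENNReal.mul_eq_top]
    · refine (ae_restrict_iff' (measurableSet_Ioc.prod measurableSet_Ioc)).2
        (ae_of_all _ fun z hz => ?_)
      by_cases h : z ∈ A
      · simp only [Function.uncurry_def, hF, indicator_of_mem h]
        exact hM _ _ hz.1.1 hz.2.1 h
      · simp only [Function.uncurry_def, hF, indicator_of_notMem h, norm_zero]
        refine (norm_nonneg _).trans (hM ((v - T) / 2) (T + (v - T) / 4) ?_ ?_ ?_) <;>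
          linarith [hz.1.1, hz.1.2]
  have h1 : ∀ t ∈ Ioc 0 (v - T), ∫ s in T..(v - t), f t s = ∫ s in Ioc T v, F t s := by
    intro t ht
    rw [intervalIntegral.integral_of_le (by linarith [ht.2]),
      ← integral_indicator measurableSet_Ioc, ← integral_indicator measurableSet_Ioc]
    congr 1
    funext s
    simp only [hF, indicator, mem_Ioc, hA, mem_ofPred_eq, Function.uncurry]
    have := ht.1
    by_cases h1 : T < s
    · by_cases h2 : s + t ≤ v
      · rw [if_pos ⟨h1, by linarith⟩, if_pos ⟨h1, by linarith⟩, if_pos h2]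
      · rw [if_neg (fun h => h2 (by linarith [h.2])), if_neg h2]
        simp
    · rw [if_neg (fun h => h1 h.1), if_neg (fun h => h1 h.1)]
  have h2 : ∀ s ∈ Ioc T v, ∫ t in (0 : ℝ)..(v - s), f t s = ∫ t in Ioc 0 (v - T), F t s := by
    intro s hs
    rw [intervalIntegral.integral_of_le (by linarith [hs.2]),
      ← integral_indicator measurableSet_Ioc, ← integral_indicator measurableSet_Ioc]
    congr 1
    funext t
    simp only [hF, indicator, mem_Ioc, hA, mem_ofPred_eq, Function.uncurry]
    have := hs.1
    by_cases h1 : 0 < t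
    · by_cases h2 : s + t ≤ v
      · rw [if_pos ⟨h1, by linarith⟩, if_pos ⟨h1, by linarith⟩, if_pos h2]
      · rw [if_neg (fun h => h2 (by linarith [h.2])), if_neg h2]
        simp
    · rw [if_neg (fun h => h1 h.1), if_neg (fun h => h1 h.1)]
  rw [intervalIntegral.integral_of_le (by linarith), intervalIntegral.integral_of_le hTv,
    setIntegral_congr_fun measurableSet_Ioc h1, setIntegral_congr_fun measurableSet_Ioc h2]
  exact integral_integral_swap hFi

/-- `truncSol χ σ T` solves the equation for the truncated kernel up to `2 T`: after inserting the
definition of `truncSol`, the double integral collapses by Fubini and the equation for `σ`. -/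
theorem SolvesUpTo.trunc {χ σ : ℝ → ℝ} {X T Y : ℝ} (hχ : IsKernel χ) (hσ : SolvesUpTo χ σ X)
    (hT : 1 ≤ T) (hYX : Y ≤ X) (hYT : Y ≤ 2 * T) :
    SolvesUpTo (truncKernel χ T) (truncSol χ σ T) Y where
  continuous := hσ.continuous_truncSol hχ hT
  eq_one u hu := by rw [truncSol_of_le (hu.trans hT), hσ.eq_one u hu]
  integral_eq v hv1 hvY := by
    have hc := hσ.continuous_truncSol hχ hT
    have hs := hσ.continuous
    rcases le_or_gt v T with hvT | hvT
    · rw [truncSol_of_le hvT, hσ.integral_eq v hv1 (hvY.trans hYX)]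
      refine intervalIntegral.integral_congr fun t ht => ?_
      rw [uIcc_of_le (by linarith)] at ht
      rw [truncKernel_of_le (ht.2.trans hvT), truncSol_of_le (by linarith [ht.1])]
    have hsv : Continuous fun t => σ (v - t) := by fun_prop
    set I : ℝ → ℝ := fun x => ∫ s in T..(max T x), χ s / s * σ (x - s) with hI
    have hIc : Continuous I := by
      have h := hs.sub hc
      convert! h using 1
      funext x
      simp [hI, truncSol]
    have hi := hχ.intervalIntegrable_mul hsv
    have hiI := hχ.intervalIntegrable_mul (f := fun t => I (v - t)) (by fun_prop)
    -- the kernel side, in terms of `σ` and `I`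
    have h1 : ∫ t in (0 : ℝ)..v, truncKernel χ T t * truncSol χ σ T (v - t)
        = (∫ t in (0 : ℝ)..T, χ t * σ (v - t)) - ∫ t in (0 : ℝ)..T, χ t * I (v - t) := by
      have hit := (hχ.trunc hT).intervalIntegrable_mul (f := fun t => truncSol χ σ T (v - t))
        (by fun_prop)
      have h2 : ∫ t in T..v, truncKernel χ T t * truncSol χ σ T (v - t) = 0 := by
        refine intervalIntegral.integral_zero_ae (ae_of_all _ fun t ht => ?_)
        rw [uIoc_of_le hvT.le] at ht
        rw [truncKernel_of_lt ht.1, zero_mul]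
      rw [← intervalIntegral.integral_add_adjacent_intervals (hit 0 T) (hit T v), h2, add_zero,
        ← intervalIntegral.integral_sub (hi 0 T) (hiI 0 T)]
      refine intervalIntegral.integral_congr fun t ht => ?_
      rw [uIcc_of_le (by linarith)] at ht
      simp only [truncKernel_of_le ht.2, truncSol, hI]
      ring
    -- `I` vanishes on `(-∞, T]`
    have h2 : ∫ t in (0 : ℝ)..T, χ t * I (v - t)
        = ∫ t in (0 : ℝ)..(v - T), ∫ s in T..(v - t), χ t * (χ s / s * σ (v - t - s)) := by
      have h3 : ∫ t in (v - T)..T, χ t * I (v - t) = 0 := by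
        refine intervalIntegral.integral_zero_ae (ae_of_all _ fun t ht => ?_)
        rw [uIoc_of_le (by linarith)] at ht
        simp only [hI]
        rw [max_eq_left (by linarith [ht.1]), intervalIntegral.integral_same, mul_zero]
      rw [← intervalIntegral.integral_add_adjacent_intervals (hiI 0 (v - T)) (hiI (v - T) T), h3,
        add_zero]
      refine intervalIntegral.integral_congr fun t ht => ?_
      rw [uIcc_of_le (by linarith)] at ht
      simp only [hI]
      rw [max_eq_right (by linarith [ht.2]), intervalIntegral.integral_const_mul]
    have h3 : ∫ t in (0 : ℝ)..(v - T), ∫ s in T..(v - t), χ t * (χ s / s * σ (v - t - s))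
        = ∫ s in T..v, ∫ t in (0 : ℝ)..(v - s), χ t * (χ s / s * σ (v - t - s)) := by
      obtain ⟨M, hM⟩ := (isCompact_Icc (a := (0 : ℝ)) (b := v)).exists_bound_of_continuousOn
        hs.continuousOn
      refine integral_integral_triangle_swap (M := M) hvT.le ?_ ?_
      · have hm := hχ.measurable
        have hsm := hs.measurable
        simp only [Function.uncurry_def]
        fun_prop
      · intro t s ht hTs hle
        have hs1 : 1 < s := hT.trans_lt hTs
        rw [norm_mul, norm_mul, norm_div, Real.norm_of_nonneg (hχ.nonneg t),
          Real.norm_of_nonneg (hχ.nonneg s), Real.norm_of_nonneg (by linarith)]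
        have hb : ‖σ (v - t - s)‖ ≤ M := hM _ ⟨by linarith, by linarith⟩
        have hq : χ s / s ≤ 1 := by
          rw [div_le_one (by linarith)]
          linarith [hχ.le_one s]
        have hq0 : 0 ≤ χ s / s := div_nonneg (hχ.nonneg s) (by linarith)
        calc χ t * (χ s / s * ‖σ (v - t - s)‖) ≤ 1 * (1 * M) := by
              gcongr
              exact hχ.le_one t
          _ = M := by ring
    have h4 : ∫ s in T..v, ∫ t in (0 : ℝ)..(v - s), χ t * (χ s / s * σ (v - t - s))
        = ∫ s in T..v, (v * (χ s / s * σ (v - s)) - χ s * σ (v - s)) := by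
      refine intervalIntegral.integral_congr fun s hs' => ?_
      rw [uIcc_of_le hvT.le] at hs'
      have hs0 : 0 < s := by linarith [hs'.1]
      have h5 : ∫ t in (0 : ℝ)..(v - s), χ t * σ (v - s - t) = (v - s) * σ (v - s) := by
        rcases le_or_gt (v - s) 1 with h6 | h6
        · rw [hσ.eq_one _ h6, mul_one]
          have : ∫ t in (0 : ℝ)..(v - s), χ t * σ (v - s - t) = ∫ t in (0 : ℝ)..(v - s), 1 := by
            refine intervalIntegral.integral_congr fun t ht => ?_
            rw [uIcc_of_le (by linarith [hs'.2])] at ht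
            rw [hχ.eq_one t (ht.2.trans h6), hσ.eq_one _ (by linarith [ht.1]), mul_one]
          rw [this]
          simp
        · exact (hσ.integral_eq _ h6 (by linarith)).symm
      have h6 : ∀ t, χ t * (χ s / s * σ (v - t - s)) = χ s / s * (χ t * σ (v - s - t)) := by
        intro t
        rw [sub_right_comm]
        ring
      simp only [h6]
      rw [intervalIntegral.integral_const_mul, h5]
      field_simp
    have h5 := hχ.intervalIntegrable_div_mul hsv hT hvT.le
    rw [h1, h2, h3, h4, intervalIntegral.integral_sub (h5.const_mul v) (hi T v),
      intervalIntegral.integral_const_mul, truncSol_of_ge hvT.le]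
    have h6 := intervalIntegral.integral_add_adjacent_intervals (hi 0 T) (hi T v)
    have h7 := hσ.integral_eq v hv1 (hvY.trans hYX)
    rw [mul_sub]
    linarith

/-! ### Rearrangement of the kernel -/

namespace IsKernel

variable {χ : ℝ → ℝ} (hχ : IsKernel χ)

include hχ

/-- Quantitative form of `integral_le_integral_mul`: `c = r / E(r)` is the point for which the
kernel `1_{[0, c]}` has the same value of `E(r)` as `χ`. With respect to the measure `dt / t` both
kernels have the same mass on `[0, r]`, and `t φ(t)` is nondecreasing. -/
theorem integral_add_le_integral_mul {φ : ℝ → ℝ} {r c c' : ℝ} (hφ : Continuous φ) (hr : 0 < r)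
    (hc : c = r / Echi χ r) (hmono : MonotoneOn φ (Icc 0 r)) (h0 : ∀ t ∈ Icc 0 r, 0 ≤ φ t)
    (hc'0 : 0 ≤ c') (hc'c : c' ≤ c) :
    (∫ t in (0 : ℝ)..c, φ t) + (c - c') * φ c * logDefect χ c'
      ≤ ∫ t in (0 : ℝ)..r, χ t * φ t := by
  have hE := Echi_pos χ r
  have hc0 : 0 < c := hc ▸ div_pos hr hE
  have hcr : c ≤ r := hc ▸ div_le_self hr.le (hχ.one_le_Echi r)
  have hφc : 0 ≤ φ c := h0 c ⟨hc0.le, hcr⟩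
  have hd := hχ.intervalIntegrable_defect
  have hi := hχ.intervalIntegrable_compl_mul hφ
  have hbound : ∀ t e, 0 ≤ t → t ≤ e → e ≤ c → (1 - χ t) * φ t ≤ e * φ c * ((1 - χ t) / t) := by
    intro t e ht hte hec
    rcases ht.eq_or_lt with rfl | ht0
    · simp [hχ.eq_one 0 zero_le_one]
    have h1 : φ t ≤ φ c := hmono ⟨ht, by linarith⟩ ⟨hc0.le, hcr⟩ (by linarith)
    have h2 : t * φ t ≤ e * φ c :=
      mul_le_mul hte h1 (h0 t ⟨ht, by linarith⟩) (by linarith)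
    have h3 := mul_le_mul_of_nonneg_right h2 (hχ.defect_nonneg t)
    calc (1 - χ t) * φ t = t * φ t * ((1 - χ t) / t) := by field_simp
      _ ≤ _ := h3
  have h1 : ∫ t in (0 : ℝ)..c', (1 - χ t) * φ t ≤ c' * φ c * logDefect χ c' := by
    rw [logDefect, ← intervalIntegral.integral_const_mul]
    exact intervalIntegral.integral_mono_on hc'0 (hi _ _) ((hd _ _).const_mul _)
      fun t ht => hbound t c' ht.1 ht.2 hc'c
  have h2 : ∫ t in c'..c, (1 - χ t) * φ t ≤ c * φ c * (logDefect χ c - logDefect χ c') := by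
    rw [hχ.logDefect_sub, ← intervalIntegral.integral_const_mul]
    exact intervalIntegral.integral_mono_on hc'c (hi _ _) ((hd _ _).const_mul _)
      fun t ht => hbound t c (hc'0.trans ht.1) ht.2 le_rfl
  have hinv : IntervalIntegrable (fun t : ℝ => t⁻¹) volume c r :=
    intervalIntegral.intervalIntegrable_inv (fun x hx => by
      rw [uIcc_of_le hcr] at hx
      linarith [hx.1]) continuousOn_id
  have h3 : c * φ c * logDefect χ c ≤ ∫ t in c..r, χ t * φ t := by
    have h4 : ∫ t in c..r, (t⁻¹ - (1 - χ t) / t) = logDefect χ c := by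
      rw [intervalIntegral.integral_sub hinv (hd _ _), integral_inv_of_pos hc0 hr,
        ← hχ.logDefect_sub, hc, div_div_cancel₀ hr.ne', log_Echi]
      ring
    rw [← h4, ← intervalIntegral.integral_const_mul]
    refine intervalIntegral.integral_mono_on hcr ((hinv.sub (hd _ _)).const_mul _)
      (hχ.intervalIntegrable_mul hφ _ _) fun t ht => ?_
    have ht0 : 0 < t := hc0.trans_le ht.1
    have h5 : c * φ c ≤ t * φ t :=
      mul_le_mul ht.1 (hmono ⟨hc0.le, hcr⟩ ⟨ht0.le, ht.2⟩ ht.1) hφc ht0.le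
    have h6 : t⁻¹ - (1 - χ t) / t = χ t / t := by
      field_simp
      ring
    rw [h6]
    calc c * φ c * (χ t / t) ≤ t * φ t * (χ t / t) :=
          mul_le_mul_of_nonneg_right h5 (div_nonneg (hχ.nonneg t) ht0.le)
      _ = χ t * φ t := by field_simp
  have hj := hχ.intervalIntegrable_mul hφ
  have h4 := intervalIntegral.integral_add_adjacent_intervals (hj 0 c) (hj c r)
  have h5 := intervalIntegral.integral_add_adjacent_intervals (hi 0 c') (hi c' c)
  have h6 : ∫ t in (0 : ℝ)..c, (1 - χ t) * φ t
      = (∫ t in (0 : ℝ)..c, φ t) - ∫ t in (0 : ℝ)..c, χ t * φ t := by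
    rw [← intervalIntegral.integral_sub (hφ.intervalIntegrable _ _) (hj _ _)]
    exact intervalIntegral.integral_congr fun t _ => by ring
  linarith

/-- The rearrangement inequality: the kernel `1_{[0, c]}` minimises the integral against a
nondecreasing function among all kernels with the given value of `E(r)`. -/
theorem integral_le_integral_mul {φ : ℝ → ℝ} {r c : ℝ} (hφ : Continuous φ) (hr : 0 < r)
    (hc : c = r / Echi χ r) (hmono : MonotoneOn φ (Icc 0 r)) (h0 : ∀ t ∈ Icc 0 r, 0 ≤ φ t) :
    ∫ t in (0 : ℝ)..c, φ t ≤ ∫ t in (0 : ℝ)..r, χ t * φ t := by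
  have h := hχ.integral_add_le_integral_mul hφ hr hc hmono h0
    (hc ▸ (div_pos hr (Echi_pos χ r)).le) le_rfl
  simpa using h

/-- Equality in the rearrangement inequality for a positive function forces `E(c) = 1`. -/
theorem logDefect_eq_zero_of_integral_mul_le {φ : ℝ → ℝ} {r c : ℝ} (hφ : Continuous φ)
    (hr : 0 < r) (hc : c = r / Echi χ r) (hmono : MonotoneOn φ (Icc 0 r))
    (h0 : ∀ t ∈ Icc 0 r, 0 < φ t)
    (hle : ∫ t in (0 : ℝ)..r, χ t * φ t ≤ ∫ t in (0 : ℝ)..c, φ t) : logDefect χ c = 0 := by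
  have hc0 : 0 < c := hc ▸ div_pos hr (Echi_pos χ r)
  have hcr : c ≤ r := hc ▸ div_le_self hr.le (hχ.one_le_Echi r)
  by_contra hne
  have hpos : 0 < logDefect χ c := (hχ.logDefect_nonneg c).lt_of_ne' hne
  obtain ⟨c', hc', hc'm⟩ := ((hχ.continuous_logDefect.continuousAt.eventually
    (lt_mem_nhds hpos)).filter_mono nhdsWithin_le_nhds |>.and
    (Ioo_mem_nhdsLT hc0)).exists
  have h := hχ.integral_add_le_integral_mul hφ hr hc hmono (fun t ht => (h0 t ht).le)
    hc'm.1.le hc'm.2.le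
  have h1 : 0 < (c - c') * φ c * logDefect χ c' :=
    mul_pos (mul_pos (sub_pos.2 hc'm.2) (h0 c ⟨hc0.le, hcr⟩)) hc'
  linarith

end IsKernel

/-! ### Comparison with the truncated kernel -/

theorem integral_dickmanRho_mul_sub (A u p q : ℝ) :
    A * ∫ t in p..q, dickmanRho (A * (u - t)) = ∫ x in (A * (u - q))..(A * (u - p)),
      dickmanRho x := by
  rw [intervalIntegral.integral_comp_sub_left (fun t => dickmanRho (A * t)),
    intervalIntegral.mul_integral_comp_mul_left]

/-- The integral form of the delay equation, scaled so that it is the integral equation for the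
kernel `1_{[0, 1 / A]}`. -/
theorem mul_dickmanRho_eq_integral {A u : ℝ} (hA : 0 < A) (hAu : 1 ≤ A * u) :
    u * dickmanRho (A * u) = ∫ t in (0 : ℝ)..A⁻¹, dickmanRho (A * (u - t)) := by
  have h1 := integral_dickmanRho_mul_sub A u 0 A⁻¹
  rw [mul_sub, mul_inv_cancel₀ hA.ne', sub_zero, ← mul_dickmanRho hAu, mul_assoc] at h1
  exact (mul_left_cancel₀ hA.ne' h1).symm

namespace IsKernel

variable {χ : ℝ → ℝ} (hχ : IsKernel χ)

include hχ

/-- The change of `ρ(E_t(u))` as the truncation point `t` moves from `T` to `u`, where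
`E_t(u) = E(t) u / t` belongs to the kernel truncated at `t`: its derivative in `t` is
`ρ(E_t(u) - 1) χ(t) / t`. -/
theorem intervalIntegrable_and_integral_dickmanRho_sub {T u : ℝ} (hT : 1 ≤ T) (hTu : T ≤ u)
    (hE : 1 < Echi χ u) :
    IntervalIntegrable (fun t => χ t / t * dickmanRho (Echi χ t * (u / t) - 1)) volume T u ∧
    ∫ t in T..u, χ t / t * dickmanRho (Echi χ t * (u / t) - 1)
      = dickmanRho (Echi χ u) - dickmanRho (Echi (truncKernel χ T) u) := by
  have hu : 0 < u := by linarith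
  have hinv : AbsolutelyContinuousOnInterval (fun t : ℝ => u / t) T u := by
    refine ContDiffOn.absolutelyContinuousOnInterval ?_
    refine contDiffOn_const.div contDiffOn_id fun t ht => ?_
    rw [uIcc_of_le hTu] at ht
    have : (1 : ℝ) ≤ t := hT.trans ht.1
    simp only [ne_eq]
    linarith
  have hac := lipschitzWith_dickmanRho.locallyLipschitz.comp_absolutelyContinuousOnInterval
    ((hχ.absolutelyContinuousOnInterval_Echi T u).fun_mul hinv)
  have h := hac.intervalIntegrable_and_integral_eq_sub
    (f' := fun t => χ t / t * dickmanRho (Echi χ t * (u / t) - 1)) (by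
      filter_upwards [hχ.ae_hasDerivAt_Echi] with t hd ht
      rw [uIcc_of_le hTu] at ht
      have ht0 : 0 < t := by linarith [ht.1]
      have hw : 1 < Echi χ t * (u / t) := by
        have := hχ.Echi_mul_le ht0 ht.2
        rw [mul_div_assoc', lt_div_iff₀ ht0]
        nlinarith
      have h1 : HasDerivAt (fun t : ℝ => u / t) (-u / t ^ 2) t := by
        simpa [div_eq_mul_inv] using (hasDerivAt_inv ht0.ne').const_mul u
      have h2 := (hasDerivAt_dickmanRho hw).comp t (hd.mul h1)
      convert! h2 using 1
      have hE0 := (Echi_pos χ t).ne'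
      field_simp
      ring)
  refine ⟨h.1, ?_⟩
  rw [h.2, div_self hu.ne', mul_one, hχ.Echi_trunc_of_ge hT hTu]
  congr 2
  ring

/-- The difference `σ(u) - ρ(E(u))` compared with the same difference for the kernel truncated
at `T`. When `u ≤ 2 T`, `truncSol χ σ T u` is the value at `u` of the solution for that kernel. -/
theorem sub_dickmanRho_eq {σ : ℝ → ℝ} {T u : ℝ} (hσ : Continuous σ) (hT : 1 ≤ T)
    (hTu : T ≤ u) (hE : 1 < Echi χ u) :
    IntervalIntegrable
      (fun t => χ t / t * (σ (u - t) - dickmanRho (Echi χ t * (u / t) - 1))) volume T u ∧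
    σ u - dickmanRho (Echi χ u)
      = truncSol χ σ T u - dickmanRho (Echi (truncKernel χ T) u)
        + ∫ t in T..u, χ t / t * (σ (u - t) - dickmanRho (Echi χ t * (u / t) - 1)) := by
  obtain ⟨h1, h2⟩ := hχ.intervalIntegrable_and_integral_dickmanRho_sub hT hTu hE
  have h3 := hχ.intervalIntegrable_div_mul (f := fun t => σ (u - t)) (by fun_prop) hT hTu
  simp only [mul_sub]
  refine ⟨h3.sub h1, ?_⟩
  rw [intervalIntegral.integral_sub h3 h1, h2, truncSol_of_ge hTu]
  ring

end IsKernel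

/-! ### Lower bounds for the averaged Dickman function -/

theorem integral_dickmanRho_lt {p q : ℝ} (hp : 1 ≤ p) (hpq : p < q) :
    ∫ x in p..q, dickmanRho x < (q - p) * dickmanRho p := by
  have h := intervalIntegral.integral_lt_integral_of_continuousOn_of_le_of_exists_lt hpq
    continuous_dickmanRho.continuousOn (continuousOn_const (c := dickmanRho p))
    (fun x hx => antitone_dickmanRho hx.1.le)
    ⟨q, ⟨hpq.le, le_rfl⟩, strictAntiOn_dickmanRho hp (hp.trans hpq.le) hpq⟩
  simpa using h

theorem mul_dickmanRho_le_integral {p q : ℝ} (hpq : p ≤ q) :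
    (q - p) * dickmanRho q ≤ ∫ x in p..q, dickmanRho x := by
  have h := intervalIntegral.integral_mono_on (f := fun _ => dickmanRho q) (μ := volume) hpq
    intervalIntegrable_const (continuous_dickmanRho.intervalIntegrable p q)
    (fun x (hx : x ∈ Icc p q) => antitone_dickmanRho hx.2)
  simpa using h

/-- The numerical inequality behind `mul_dickmanRho_lt_integral_trunc`. Cancelling the integrals
over `[b, a]`, where `a = b + 1 - θ b`, reduces it to a comparison of `∫_{b-θb}^b ρ ≥ θ b ρ(b)` with
`∫_a^{b+1-θ} ρ < (θ b - θ) ρ(a)`. -/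
theorem integral_dickmanRho_lt_of_eq {a b θ : ℝ} (hb : 1 < b) (hθ : 0 < θ) (hba : b ≤ a)
    (ha : a = b + 1 - θ * b) :
    ∫ x in b..(b + 1 - θ), dickmanRho x
      < (1 - θ) * (a * dickmanRho a)
        + θ * ((∫ x in b..a, dickmanRho x) - (a - b) * dickmanRho b) := by
  have hi := fun p q => continuous_dickmanRho.intervalIntegrable (μ := volume) p q
  rw [mul_dickmanRho (hb.le.trans hba),
    ← intervalIntegral.integral_add_adjacent_intervals (hi (a - 1) b) (hi b a),
    ← intervalIntegral.integral_add_adjacent_intervals (hi b a) (hi a (b + 1 - θ))]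
  have hθb : θ * b ≤ 1 := by linarith
  have hθ1 : θ < 1 := by nlinarith
  have h1 := integral_dickmanRho_lt (p := a) (q := b + 1 - θ) (by linarith) (by nlinarith)
  have h2 := mul_dickmanRho_le_integral (p := a - 1) (q := b) (by nlinarith)
  have h3 : dickmanRho a ≤ dickmanRho b := antitone_dickmanRho hba
  have h4 : (b + 1 - θ - a) * dickmanRho a ≤ (b + 1 - θ - a) * dickmanRho b :=
    mul_le_mul_of_nonneg_left h3 (by nlinarith)
  have h5 := mul_le_mul_of_nonneg_left h2 (sub_nonneg.2 hθ1.le)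
  subst ha
  nlinarith

theorem monotone_dickmanRho_mul_sub {A : ℝ} (hA : 0 ≤ A) (u : ℝ) :
    Monotone fun t => dickmanRho (A * (u - t)) := fun _ _ hst =>
  antitone_dickmanRho (mul_le_mul_of_nonneg_left (by linarith) hA)

namespace IsKernel

variable {χ : ℝ → ℝ} (hχ : IsKernel χ)

include hχ

/-- The part of `∫ χ(t) ρ(E(u - t)) dt` over the middle interval `[r, T]`, with `u = r + T`, on
which `E` grows by at most `1`. After the reflection `t ↦ u - t`, the integrand is bounded below by
the derivative of `(s - κ E(s)) ρ(E(s)) + κ ∫_b^{E(s)} (ρ - ρ(b))`, where `b = E(r)` and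
`κ = r / b`. -/
theorem le_integral_middle {r T : ℝ} (hr : 0 < r) (hrT : r ≤ T) (hb : 1 < Echi χ r)
    (hE : Echi χ T ≤ Echi χ r + 1) :
    (T - r / Echi χ r * Echi χ T) * dickmanRho (Echi χ T)
      + r / Echi χ r * ((∫ x in (Echi χ r)..(Echi χ T), dickmanRho x)
        - (Echi χ T - Echi χ r) * dickmanRho (Echi χ r))
      ≤ ∫ t in r..T, χ t * dickmanRho (Echi χ (r + T - t)) := by
  set E := Echi χ with hEdef
  set b := E r with hbdef
  set κ := r / b with hκ
  have hb0 : 0 < b := by linarith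
  have hκb : κ * b = r := div_mul_cancel₀ r hb0.ne'
  set R : ℝ → ℝ := fun x => ∫ t in b..x, dickmanRho t with hR
  have hEc : Continuous E := hχ.continuous_Echi
  have hρc := continuous_dickmanRho
  have hid : AbsolutelyContinuousOnInterval (fun x : ℝ => x) r T :=
    LipschitzWith.id.lipschitzOnWith.absolutelyContinuousOnInterval
  have hEac : AbsolutelyContinuousOnInterval E r T := hχ.absolutelyContinuousOnInterval_Echi r T
  have hρE := lipschitzWith_dickmanRho.locallyLipschitz.comp_absolutelyContinuousOnInterval hEac
  have hRl : LocallyLipschitz R := by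
    refine ContDiff.locallyLipschitz (𝕂 := ℝ) (contDiff_one_iff_deriv.2 ⟨fun x =>
      (hasDerivAt_integral_dickmanRho b x).differentiableAt, ?_⟩)
    have : deriv R = dickmanRho := funext fun x => (hasDerivAt_integral_dickmanRho b x).deriv
    rw [this]
    exact hρc
  have hRE := hRl.comp_absolutelyContinuousOnInterval hEac
  have hac := ((hid.fun_sub (hEac.const_mul κ)).fun_mul hρE).fun_add
    ((hRE.fun_sub (hEac.const_mul (dickmanRho b))).const_mul κ)
  have hftc := hac.intervalIntegrable_and_integral_eq_sub
    (f' := fun s => dickmanRho (E s)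
      - ((s - κ * E s) * dickmanRho (E s - 1) + κ * E s * dickmanRho b) * ((1 - χ s) / s)) (by
      filter_upwards [hχ.ae_hasDerivAt_Echi] with s hd hs
      rw [← hEdef] at hd
      rw [uIcc_of_le hrT] at hs
      have hs0 : 0 < s := hr.trans_le hs.1
      have hEs : 1 < E s := hb.trans_le (hχ.monotone_Echi hs.1)
      have h1 := (hasDerivAt_dickmanRho hEs).comp s hd
      have h2 := (hasDerivAt_integral_dickmanRho b (E s)).comp s hd
      convert! (((hasDerivAt_id' s).sub (hd.const_mul κ)).mul h1).add
        ((h2.sub (hd.const_mul (dickmanRho b))).const_mul κ) using 1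
      have hE0 : E s ≠ 0 := by linarith
      simp only [Function.comp_apply, Pi.sub_apply]
      field_simp
      ring)
  have hcρ : Continuous fun t => dickmanRho (E (r + T - t)) := by fun_prop
  have hρE' : Continuous fun t => dickmanRho (E t) := by fun_prop
  have hcm := fun f : ℝ → ℝ => fun hf : Continuous f => hχ.intervalIntegrable_compl_mul hf r T
  -- replace `ρ(E(r + T - t))` by `ρ(b)` where it is weighted by `1 - χ(t)`
  have h1 : ∫ s in r..T, (dickmanRho (E s) - (1 - χ s) * dickmanRho b)
      ≤ ∫ t in r..T, χ t * dickmanRho (E (r + T - t)) := by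
    have h2 : ∫ t in r..T, χ t * dickmanRho (E (r + T - t))
        = (∫ s in r..T, dickmanRho (E s))
          - ∫ t in r..T, (1 - χ t) * dickmanRho (E (r + T - t)) := by
      have h3 : ∫ s in r..T, dickmanRho (E s) = ∫ t in r..T, dickmanRho (E (r + T - t)) := by
        rw [intervalIntegral.integral_comp_sub_left (fun t => dickmanRho (E t))]
        simp
      rw [h3, ← intervalIntegral.integral_sub (hcρ.intervalIntegrable _ _) (hcm _ hcρ)]
      exact intervalIntegral.integral_congr fun t _ => by ring
    rw [h2, intervalIntegral.integral_sub (hρE'.intervalIntegrable _ _)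
      (hcm _ continuous_const)]
    refine sub_le_sub_left (intervalIntegral.integral_mono_on hrT (hcm _ hcρ)
      (hcm _ continuous_const) fun t ht => ?_) _
    refine mul_le_mul_of_nonneg_left (antitone_dickmanRho ?_) (by linarith [hχ.le_one t])
    exact hχ.monotone_Echi (by linarith [ht.2])
  have h2 := intervalIntegral.integral_mono_on hrT hftc.1
    ((hρE'.intervalIntegrable _ _).sub (hcm _ (continuous_const (y := dickmanRho b))))
    fun s hs => by
      have hs0 : 0 < s := hr.trans_le hs.1
      have hκE : κ * E s ≤ s := by
        have := hχ.Echi_mul_le hr hs.1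
        rw [hκ, div_mul_eq_mul_div, div_le_iff₀ hb0]
        simp only [← hEdef, ← hbdef] at this
        linarith
      -- `E(s) - 1 ≤ E(T) - 1 ≤ b`
      have hρ : dickmanRho b ≤ dickmanRho (E s - 1) :=
        antitone_dickmanRho (by linarith [hχ.monotone_Echi hs.2])
      have h3 : (1 - χ s) = s * ((1 - χ s) / s) := by field_simp
      have h4 := mul_nonneg (mul_nonneg (sub_nonneg.2 hκE) (sub_nonneg.2 hρ))
        (hχ.defect_nonneg s)
      have h5 : (1 - χ s) * dickmanRho b = s * ((1 - χ s) / s) * dickmanRho b := by rw [← h3]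
      rw [h5]
      linarith
  have h3 := hftc.2
  simp only [← hbdef, hR, intervalIntegral.integral_same, hκb] at h3
  refine le_trans (le_of_eq ?_) (h2.trans h1)
  rw [h3]
  ring

/-- Lower bound for the averaged Dickman function when the kernel is truncated at `T = u / 2`;
equality forces `E(c) = 1` at `c = T / E(T)`. -/
theorem mul_dickmanRho_le_integral_trunc {T : ℝ} (hT : 1 ≤ T) :
    2 * T * dickmanRho (Echi (truncKernel χ T) (2 * T))
        ≤ ∫ t in (0 : ℝ)..T, χ t * dickmanRho (Echi (truncKernel χ T) (2 * T - t)) ∧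
    (∫ t in (0 : ℝ)..T, χ t * dickmanRho (Echi (truncKernel χ T) (2 * T - t))
        ≤ 2 * T * dickmanRho (Echi (truncKernel χ T) (2 * T)) →
      logDefect χ (T / Echi χ T) = 0) := by
  have hT0 : 0 < T := by linarith
  set A := Echi χ T / T with hA
  have hA0 : 0 < A := div_pos (Echi_pos χ T) hT0
  have hAT : A * T = Echi χ T := div_mul_cancel₀ _ hT0.ne'
  have hAinv : A⁻¹ = T / Echi χ T := by rw [hA, inv_div]
  have hE := hχ.one_le_Echi T
  rw [hχ.Echi_trunc_of_ge hT (by linarith), mul_dickmanRho_eq_integral hA0 (by linarith), hAinv]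
  have h1 : ∫ t in (0 : ℝ)..T, χ t * dickmanRho (Echi (truncKernel χ T) (2 * T - t))
      = ∫ t in (0 : ℝ)..T, χ t * dickmanRho (A * (2 * T - t)) := by
    refine intervalIntegral.integral_congr fun t ht => ?_
    rw [uIcc_of_le hT0.le] at ht
    rw [hχ.Echi_trunc_of_ge hT (by linarith [ht.2])]
  rw [h1]
  have hc : Continuous fun t => dickmanRho (A * (2 * T - t)) :=
    continuous_dickmanRho.comp (by fun_prop)
  have hmono := (monotone_dickmanRho_mul_sub hA0.le (2 * T)).monotoneOn (Icc 0 T)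
  exact ⟨hχ.integral_le_integral_mul hc hT0 rfl hmono fun t _ => dickmanRho_nonneg _,
    hχ.logDefect_eq_zero_of_integral_mul_le hc hT0 rfl hmono fun t _ => dickmanRho_pos _⟩

/-- Strict lower bound for the averaged Dickman function when the kernel is truncated at a point
`T ≥ u / 2` with `E(u - T) = E_T(u) - 1`, where `E_T` belongs to the truncated kernel. -/
theorem mul_dickmanRho_lt_integral_trunc {T u : ℝ} (hT : 1 ≤ T) (hTu : T < u) (huT : u ≤ 2 * T)
    (hb : 1 < Echi χ (u - T)) (heq : Echi (truncKernel χ T) u = Echi χ (u - T) + 1) :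
    u * dickmanRho (Echi (truncKernel χ T) u)
      < ∫ t in (0 : ℝ)..T, χ t * dickmanRho (Echi (truncKernel χ T) (u - t)) := by
  have hT0 : 0 < T := by linarith
  set r := u - T with hr
  have hr0 : 0 < r := by linarith
  have hrT : r ≤ T := by linarith
  set a := Echi χ T with ha
  set b := Echi χ r with hbdef
  set A := a / T with hA
  have ha0 : 0 < a := Echi_pos χ T
  have hA0 : 0 < A := div_pos ha0 hT0
  have hAT : A * T = a := div_mul_cancel₀ _ hT0.ne'
  have hba : b ≤ a := hχ.monotone_Echi hrT
  have hET : ∀ v, T ≤ v → Echi (truncKernel χ T) v = A * v := fun v hv =>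
    hχ.Echi_trunc_of_ge hT hv
  rw [hET u hTu.le] at heq ⊢
  have hκb : r / b * b = r := div_mul_cancel₀ r (by linarith)
  set κ := r / b with hκ
  have hκ0 : 0 < κ := div_pos hr0 (by linarith)
  have haeq : a = b + 1 - A * κ * b := by
    rw [mul_assoc, hκb, ← hAT]
    linarith [mul_sub A u T]
  -- split the integral at `r`
  have hE'c : Continuous fun t => dickmanRho (Echi (truncKernel χ T) (u - t)) :=
    continuous_dickmanRho.comp ((hχ.trunc hT).continuous_Echi.comp (by fun_prop))
  rw [← intervalIntegral.integral_add_adjacent_intervals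
    (hχ.intervalIntegrable_mul hE'c 0 r) (hχ.intervalIntegrable_mul hE'c r T)]
  have h1 : ∫ t in (0 : ℝ)..κ, dickmanRho (A * (u - t))
      ≤ ∫ t in (0 : ℝ)..r, χ t * dickmanRho (Echi (truncKernel χ T) (u - t)) := by
    have h2 : ∫ t in (0 : ℝ)..r, χ t * dickmanRho (Echi (truncKernel χ T) (u - t))
        = ∫ t in (0 : ℝ)..r, χ t * dickmanRho (A * (u - t)) := by
      refine intervalIntegral.integral_congr fun t ht => ?_
      rw [uIcc_of_le hr0.le] at ht
      rw [hET _ (by linarith [ht.2])]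
    rw [h2]
    exact hχ.integral_le_integral_mul (continuous_dickmanRho.comp (by fun_prop)) hr0 rfl
      ((monotone_dickmanRho_mul_sub hA0.le _).monotoneOn _) fun t _ => dickmanRho_nonneg _
  have h2 : ∫ t in r..T, χ t * dickmanRho (Echi (truncKernel χ T) (u - t))
      = ∫ t in r..T, χ t * dickmanRho (Echi χ (r + T - t)) := by
    refine intervalIntegral.integral_congr fun t ht => ?_
    rw [uIcc_of_le hrT] at ht
    rw [Echi_trunc_of_le hT (by linarith [ht.1]), hr, sub_add_cancel]
  have hpos : 0 < A * κ * b := mul_pos (mul_pos hA0 hκ0) (by linarith)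
  have h3 := hχ.le_integral_middle hr0 hrT hb (by rw [← ha, ← hbdef]; linarith)
  rw [← ha, ← hbdef, ← hκ] at h3
  have h4 := integral_dickmanRho_lt_of_eq hb (mul_pos hA0 hκ0) hba haeq
  have h5 := integral_dickmanRho_mul_sub A u κ A⁻¹
  rw [mul_sub, mul_inv_cancel₀ hA0.ne', heq, mul_sub A u κ, heq, add_sub_cancel_right] at h5
  have hρi := fun p q => (continuous_dickmanRho.comp
    (f := fun t => A * (u - t)) (by fun_prop)).intervalIntegrable (μ := volume) p q
  have h6 := intervalIntegral.integral_add_adjacent_intervals (hρi 0 κ) (hρi κ A⁻¹)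
  simp only [Function.comp_def] at h6
  have h7 := mul_dickmanRho_eq_integral (u := u) hA0 (by linarith)
  rw [heq] at h7
  rw [heq, h7, ← h6, h2]
  -- the remaining comparison of the parts beyond `κ` is `h4`, divided by `A`
  have h8 : A * ∫ t in κ..A⁻¹, dickmanRho (A * (u - t))
      < A * ((T - κ * a) * dickmanRho a + κ * ((∫ x in b..a, dickmanRho x)
        - (a - b) * dickmanRho b)) := by
    rw [h5]
    refine h4.trans_eq ?_
    rw [← hAT]
    ring
  have h9 := lt_of_mul_lt_mul_left h8 hA0.le
  linarith

end IsKernel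

/-! ### Choice of the truncation point -/

namespace IsKernel

variable {χ : ℝ → ℝ} (hχ : IsKernel χ)

include hχ

theorem dickmanRho_eq_of_Echi_le_two {u : ℝ} (hE : Echi χ u ≤ 2) :
    dickmanRho (Echi χ u) = 1 - logDefect χ u := by
  rw [dickmanRho_eq_one_sub_log (hχ.one_le_Echi u) hE, log_Echi]

theorem Echi_le_trunc {T u : ℝ} (hT : 1 ≤ T) (hTu : T ≤ u) :
    Echi χ u ≤ Echi (truncKernel χ T) u := by
  rw [hχ.Echi_trunc_of_ge hT hTu, div_mul_eq_mul_div, le_div_iff₀ (by linarith)]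
  exact hχ.Echi_mul_le (by linarith) hTu

/-- The truncation point `T`: the largest `T ∈ [u / 2, u]` with `E(u - T) + 1 = E_T(u)`, where
`E_T(u) = E(T) u / T` belongs to the kernel truncated at `T`, or `u / 2` if there is none. Beyond
`T` one has `E(u - t) + 1 < E_t(u)`. -/
theorem exists_truncation_point {u : ℝ} (hu : 2 < Echi χ u) :
    ∃ T, 1 ≤ T ∧ T < u ∧ u ≤ 2 * T ∧ (∀ t ∈ Ioc T u, Echi χ (u - t) + 1 < Echi χ t * (u / t)) ∧
      (u = 2 * T ∧ Echi χ (u - T) + 1 < Echi χ T * (u / T) ∨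
        1 < Echi χ (u - T) ∧ Echi (truncKernel χ T) u = Echi χ (u - T) + 1) := by
  have hu1 : 1 < u := by
    by_contra! h
    rw [hχ.Echi_of_le_one h] at hu
    linarith
  have hu2 : 2 < u := by
    have h := hχ.Echi_mul_le one_pos hu1.le
    rw [hχ.Echi_of_le_one le_rfl] at h
    linarith
  set φ : ℝ → ℝ := fun t => Echi χ (u - t) + 1 - Echi χ t * (u / t) with hφ
  have hE := hχ.continuous_Echi
  have hφc : ContinuousOn φ (Icc (u / 2) u) := by
    refine ContinuousOn.sub (by fun_prop) (hE.continuousOn.mul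
      (continuousOn_const.div continuousOn_id fun t ht => ?_))
    have : u / 2 ≤ t := ht.1
    have : 0 < t := by linarith
    exact this.ne'
  have hφu : φ u < 0 := by
    simp only [hφ, sub_self, div_self (show u ≠ 0 by linarith),
      hχ.Echi_of_le_one (zero_le_one' ℝ)]
    linarith
  -- without a zero in `[t, u]`, the sign of `φ` at `t` is that of `φ(u)`
  have hsign : ∀ t, u / 2 ≤ t → t ≤ u → (∀ s ∈ Icc t u, φ s ≠ 0) → φ t < 0 := by
    intro t ht htu hne
    by_contra! h
    obtain ⟨s, hs, hs0⟩ := intermediate_value_Icc' htu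
      (hφc.mono (Icc_subset_Icc_left ht)) ⟨hφu.le, h⟩
    exact hne s hs hs0
  by_cases hZ : (Icc (u / 2) u ∩ φ ⁻¹' {0}).Nonempty
  · have hcomp : IsCompact (Icc (u / 2) u ∩ φ ⁻¹' {0}) :=
      isCompact_Icc.of_isClosed_subset
        (hφc.preimage_isClosed_of_isClosed isClosed_Icc isClosed_singleton) inter_subset_left
    obtain ⟨T, ⟨hTm, hT0⟩, hTmax⟩ := hcomp.exists_isGreatest hZ
    have hT0 : φ T = 0 := hT0
    have hT1 : 1 ≤ T := by linarith [hTm.1]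
    have hTu : T < u := by
      refine hTm.2.lt_of_ne fun h => ?_
      rw [h] at hT0
      linarith
    have heq : Echi (truncKernel χ T) u = Echi χ (u - T) + 1 := by
      rw [hχ.Echi_trunc_of_ge hT1 hTu.le]
      simp only [hφ] at hT0
      have : Echi χ T / T * u = Echi χ T * (u / T) := by ring
      linarith
    refine ⟨T, hT1, hTu, by linarith [hTm.1], fun t ht => ?_, .inr ⟨?_, heq⟩⟩
    · have := hsign t (by linarith [hTm.1, ht.1]) ht.2 fun s hs hs0 => by
        have := hTmax ⟨⟨by linarith [hTm.1, ht.1, hs.1], hs.2⟩, hs0⟩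
        linarith [ht.1, hs.1]
      simp only [hφ] at this
      linarith
    · linarith [hχ.Echi_le_trunc hT1 hTu.le]
  · refine ⟨u / 2, by linarith, by linarith, by linarith, ?_, .inl ⟨by ring, ?_⟩⟩
    · intro t ht
      have := hsign t ht.1.le ht.2 fun s hs hs0 => hZ ⟨s, ⟨by linarith [ht.1, hs.1], hs.2⟩, hs0⟩
      simp only [hφ] at this
      linarith
    · have := hsign (u / 2) le_rfl (by linarith) fun s hs hs0 => hZ ⟨s, hs, hs0⟩
      simp only [hφ] at this
      linarith

end IsKernel

/-! ### The lower bound -/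

theorem SolvesUpTo.mul_eq_integral_trunc {χ τ : ℝ → ℝ} {T u : ℝ} (hχ : IsKernel χ) (hT : 1 ≤ T)
    (hτ : SolvesUpTo (truncKernel χ T) τ u) (hTu : T < u) :
    u * τ u = ∫ t in (0 : ℝ)..T, χ t * τ (u - t) := by
  have hi := (hχ.trunc hT).intervalIntegrable_mul (f := fun t => τ (u - t))
    (hτ.continuous.comp (by fun_prop))
  have h1 : ∫ t in T..u, truncKernel χ T t * τ (u - t) = 0 := by
    refine intervalIntegral.integral_zero_ae (ae_of_all _ fun t ht => ?_)
    rw [uIoc_of_le hTu.le] at ht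
    rw [truncKernel_of_lt ht.1, zero_mul]
  rw [hτ.integral_eq u (hT.trans_lt hTu) le_rfl,
    ← intervalIntegral.integral_add_adjacent_intervals (hi 0 T) (hi T u), h1, add_zero]
  refine intervalIntegral.integral_congr fun t ht => ?_
  rw [uIcc_of_le (by linarith)] at ht
  simp only [truncKernel_of_le ht.2]

/-- The lower bound `σ(u) ≥ ρ(E(u))` with an error `c`, for all kernels and all `u ≤ x`. -/
def DickmanLowerBound (x c : ℝ) : Prop :=
  ∀ (χ σ : ℝ → ℝ) (u : ℝ), IsKernel χ → SolvesUpTo χ σ u → u ≤ x →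
    dickmanRho (Echi χ u) - c ≤ σ u

namespace IsKernel

variable {χ σ : ℝ → ℝ} {u : ℝ} (hχ : IsKernel χ) (hσ : SolvesUpTo χ σ u)

include hχ hσ

/-- The averaged Dickman function of the truncated kernel is a lower bound for `u σ_T(u)`, up to
the error `c` that is only incurred for `t ∈ [0, 1]`. -/
theorem integral_trunc_sub_le {T x c : ℝ} (hT : 1 ≤ T) (hTu : T < u) (huT : u ≤ 2 * T)
    (hx : DickmanLowerBound x 0) (hx1 : DickmanLowerBound (x + 1) c)
    (hux : u ≤ x + 1) :
    (∫ t in (0 : ℝ)..T, χ t * dickmanRho (Echi (truncKernel χ T) (u - t))) - c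
      ≤ u * truncSol χ σ T u := by
  have hτ := hσ.trunc hχ hT le_rfl huT
  rw [hτ.mul_eq_integral_trunc hχ hT hTu]
  have hi := hχ.intervalIntegrable_mul
    (f := fun t => dickmanRho (Echi (truncKernel χ T) (u - t)))
    (continuous_dickmanRho.comp ((hχ.trunc hT).continuous_Echi.comp (by fun_prop)))
  have hj := hχ.intervalIntegrable_mul (f := fun t => truncSol χ σ T (u - t))
    (hτ.continuous.comp (by fun_prop))
  rw [← intervalIntegral.integral_add_adjacent_intervals (hi 0 1) (hi 1 T),
    ← intervalIntegral.integral_add_adjacent_intervals (hj 0 1) (hj 1 T)]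
  have h1 : (∫ t in (0 : ℝ)..1, χ t * dickmanRho (Echi (truncKernel χ T) (u - t))) - c
      ≤ ∫ t in (0 : ℝ)..1, χ t * truncSol χ σ T (u - t) := by
    have h2 : (∫ t in (0 : ℝ)..1, χ t * dickmanRho (Echi (truncKernel χ T) (u - t))) - c
        = ∫ t in (0 : ℝ)..1, (χ t * dickmanRho (Echi (truncKernel χ T) (u - t)) - c) := by
      rw [intervalIntegral.integral_sub (hi 0 1) (by simp)]
      simp
    rw [h2]
    refine intervalIntegral.integral_mono_on zero_le_one ((hi 0 1).sub (by simp)) (hj 0 1)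
      fun t ht => ?_
    rw [hχ.eq_one t ht.2, one_mul, one_mul]
    exact hx1 _ _ _ (hχ.trunc hT) (hτ.mono (by linarith [ht.1])) (by linarith [ht.1])
  have h2 : ∫ t in (1 : ℝ)..T, χ t * dickmanRho (Echi (truncKernel χ T) (u - t))
      ≤ ∫ t in (1 : ℝ)..T, χ t * truncSol χ σ T (u - t) := by
    refine intervalIntegral.integral_mono_on hT (hi 1 T) (hj 1 T) fun t ht => ?_
    refine mul_le_mul_of_nonneg_left ?_ (hχ.nonneg t)
    have := hx _ _ (u - t) (hχ.trunc hT) (hτ.mono (by linarith [ht.1])) (by linarith [ht.1])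
    simpa using this
  linarith

/-- The integrand in `sub_dickmanRho_eq` is nonnegative beyond the truncation point. -/
theorem sub_dickmanRho_nonneg {T x t : ℝ} (hx : DickmanLowerBound x 0) (hux : u ≤ x + 1) (hT : 1 ≤ T)
    (hle : ∀ t ∈ Ioc T u, Echi χ (u - t) + 1 < Echi χ t * (u / t)) (ht : t ∈ Ioc T u) :
    0 ≤ σ (u - t) - dickmanRho (Echi χ t * (u / t) - 1) := by
  have h1 := hx χ σ (u - t) hχ (hσ.mono (by linarith [ht.1])) (by linarith [ht.1])
  have h2 := antitone_dickmanRho (show Echi χ (u - t) ≤ Echi χ t * (u / t) - 1 by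
    linarith [hle t ht])
  linarith

/-- One step of the improvement of the error term: the error is divided by `u ≥ 2`. -/
theorem dickmanRho_sub_half_le {x c : ℝ} (hc : 0 ≤ c) (hx : DickmanLowerBound x 0)
    (hx1 : DickmanLowerBound (x + 1) c) (hux : u ≤ x + 1) :
    dickmanRho (Echi χ u) - c / 2 ≤ σ u := by
  rcases le_or_gt (Echi χ u) 2 with hE | hE
  · rw [hχ.dickmanRho_eq_of_Echi_le_two hE]
    linarith [hχ.one_sub_logDefect_le hσ le_rfl]
  obtain ⟨T, hT, hTu, huT, hle, hcase⟩ := hχ.exists_truncation_point hE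
  obtain ⟨-, h1⟩ := hχ.sub_dickmanRho_eq hσ.continuous hT hTu.le (by linarith)
  have h2 : 0 ≤ ∫ t in T..u, χ t / t * (σ (u - t) - dickmanRho (Echi χ t * (u / t) - 1)) := by
    rw [intervalIntegral.integral_of_le hTu.le]
    refine setIntegral_nonneg measurableSet_Ioc fun t ht => ?_
    exact mul_nonneg (div_nonneg (hχ.nonneg t) (by linarith [ht.1]))
      (hχ.sub_dickmanRho_nonneg hσ hx hux hT hle ht)
  have h3 := hχ.integral_trunc_sub_le hσ hT hTu huT hx hx1 hux
  have h4 : u * dickmanRho (Echi (truncKernel χ T) u)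
      ≤ ∫ t in (0 : ℝ)..T, χ t * dickmanRho (Echi (truncKernel χ T) (u - t)) := by
    rcases hcase with ⟨rfl, -⟩ | ⟨hb, heq⟩
    · exact (hχ.mul_dickmanRho_le_integral_trunc hT).1
    · exact (hχ.mul_dickmanRho_lt_integral_trunc hT hTu huT hb heq).le
  have hu2 : 2 < u := by
    have h := hχ.Echi_mul_le one_pos (hT.trans hTu.le)
    rw [hχ.Echi_of_le_one le_rfl] at h
    linarith
  have h5 : dickmanRho (Echi (truncKernel χ T) u) - c / 2 ≤ truncSol χ σ T u := by
    refine le_of_mul_le_mul_left ?_ (show 0 < u by linarith)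
    nlinarith
  linarith

end IsKernel

/-- `σ(u) ≥ ρ(E(u))`, by induction on `⌈x⌉`; the error term starts at `c = 1`, because `σ ≥ 0` and
`ρ ≤ 1`, and is halved indefinitely. -/
theorem dickmanLowerBound_zero (x : ℝ) : DickmanLowerBound x 0 := by
  obtain ⟨n, hn⟩ := exists_nat_ge x
  suffices h : DickmanLowerBound n 0 from fun χ σ u hχ hσ hu => h χ σ u hχ hσ (hu.trans hn)
  clear hn x
  induction n with
  | zero =>
    intro χ σ u hχ hσ hu
    have hu1 : u ≤ 1 := hu.trans (by simp)
    rw [hσ.eq_one u hu1, sub_zero]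
    exact dickmanRho_le_one _
  | succ n ih =>
    push_cast
    have hk : ∀ k : ℕ, DickmanLowerBound ((n : ℝ) + 1) ((1 / 2) ^ k) := by
      intro k
      induction k with
      | zero =>
        intro χ σ u hχ hσ _
        have := hσ.nonneg hχ le_rfl
        have := dickmanRho_le_one (Echi χ u)
        rw [pow_zero]
        linarith
      | succ k ihk =>
        intro χ σ u hχ hσ hu
        have := hχ.dickmanRho_sub_half_le hσ (by positivity) ih ihk hu
        rw [pow_succ]
        linarith
    intro χ σ u hχ hσ hu
    have hlim := (tendsto_pow_atTop_nhds_zero_of_lt_one (show (0 : ℝ) ≤ 1 / 2 by norm_num)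
      (by norm_num)).const_sub (dickmanRho (Echi χ u))
    exact le_of_tendsto' hlim fun k => hk k χ σ u hχ hσ hu

namespace IsKernel

variable {χ σ : ℝ → ℝ} {u : ℝ} (hχ : IsKernel χ) (hσ : SolvesUpTo χ σ u)

include hχ hσ

theorem dickmanRho_Echi_le : dickmanRho (Echi χ u) ≤ σ u := by
  simpa using dickmanLowerBound_zero u χ σ u hχ hσ le_rfl

/-! ### The cases of equality -/

theorem Echi_half_eq_one (hE : Echi χ u ≤ 2) (heq : σ u = dickmanRho (Echi χ u)) :
    Echi χ (u / 2) = 1 := by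
  rw [hχ.dickmanRho_eq_of_Echi_le_two hE] at heq
  rw [Echi_eq_exp, hχ.logDefect_half_eq_zero hσ le_rfl heq, Real.exp_zero]

theorem Echi_div_eq_one_of_two_lt (hE : 2 < Echi χ u) (heq : σ u = dickmanRho (Echi χ u)) :
    Echi χ (u / Echi χ u) = 1 := by
  obtain ⟨T, hT, hTu, huT, hle, hcase⟩ := hχ.exists_truncation_point hE
  have hT0 : 0 < T := by linarith
  have hu0 : 0 < u := by linarith
  obtain ⟨hint, h1⟩ := hχ.sub_dickmanRho_eq hσ.continuous hT hTu.le (by linarith)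
  have hlb := dickmanLowerBound_zero
  have hbr : ∀ t ∈ Ioc T u, 0 ≤ χ t / t * (σ (u - t) - dickmanRho (Echi χ t * (u / t) - 1)) :=
    fun t ht => mul_nonneg (div_nonneg (hχ.nonneg t) (by linarith [ht.1]))
      (hχ.sub_dickmanRho_nonneg hσ (hlb u) (by linarith) hT hle ht)
  have h2 : 0 ≤ ∫ t in T..u, χ t / t * (σ (u - t) - dickmanRho (Echi χ t * (u / t) - 1)) := by
    rw [intervalIntegral.integral_of_le hTu.le]
    exact setIntegral_nonneg measurableSet_Ioc hbr
  have h3 := hχ.integral_trunc_sub_le hσ hT hTu huT (hlb u) (hlb (u + 1)) (by linarith)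
  rw [heq, sub_self] at h1
  rcases hcase with ⟨hu2, hltT⟩ | ⟨hb, heq'⟩
  swap
  · have h4 := hχ.mul_dickmanRho_lt_integral_trunc hT hTu huT hb heq'
    have h5 : dickmanRho (Echi (truncKernel χ T) u) < truncSol χ σ T u := by
      refine lt_of_mul_lt_mul_left ?_ hu0.le
      linarith
    linarith
  have h4 := hχ.mul_dickmanRho_le_integral_trunc hT
  rw [← hu2] at h4
  have h5 : dickmanRho (Echi (truncKernel χ T) u) ≤ truncSol χ σ T u := by
    refine le_of_mul_le_mul_left ?_ hu0
    linarith [h4.1]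
  have h6 : truncSol χ σ T u = dickmanRho (Echi (truncKernel χ T) u) := by linarith
  have h7 := h4.2 (by rw [h6] at h3; linarith)
  -- since the brackets are bounded below on `[T, u]`, the vanishing of their integral forces
  -- `E(u) = E(T) u / T`
  suffices h8 : Echi χ u = Echi χ T * (u / T) by
    have : u / Echi χ u = T / Echi χ T := by
      have := (Echi_pos χ T).ne'
      rw [h8]
      field_simp
    rw [this, Echi_eq_exp, h7, Real.exp_zero]
  by_contra hne
  have hEc := hχ.continuous_Echi
  have hlt : ∀ t ∈ Icc T u, Echi χ (u - t) + 1 < Echi χ t * (u / t) := fun t ht => by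
    rcases ht.1.eq_or_lt with rfl | h
    · exact hltT
    · exact hle t ⟨h, ht.2⟩
  have hcont : ContinuousOn (fun t => dickmanRho (Echi χ (u - t))
      - dickmanRho (Echi χ t * (u / t) - 1)) (Icc T u) := by
    refine ContinuousOn.sub (continuous_dickmanRho.comp (by fun_prop)).continuousOn
      (continuous_dickmanRho.comp_continuousOn ((hEc.continuousOn.mul
        (continuousOn_const.div continuousOn_id fun t ht => ?_)).sub continuousOn_const))
    exact (hT0.trans_le ht.1).ne'
  obtain ⟨m, hm, hmin⟩ := isCompact_Icc.exists_isMinOn (nonempty_Icc.2 hTu.le) hcont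
  set μ := dickmanRho (Echi χ (u - m)) - dickmanRho (Echi χ m * (u / m) - 1) with hμ
  have hμ0 : 0 < μ := by
    have h8 := hlt m hm
    have h9 := hχ.one_le_Echi (u - m)
    exact sub_pos.2 (strictAntiOn_dickmanRho h9 (by simp only [mem_Ici]; linarith) (by linarith))
  have hmass : ∫ t in T..u, χ t / t * 1
      = Real.log (u / T) - (logDefect χ u - logDefect χ T) := by
    have hinv : IntervalIntegrable (fun t : ℝ => t⁻¹) volume T u :=
      intervalIntegral.intervalIntegrable_inv (fun x hx => by
        rw [uIcc_of_le hTu.le] at hx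
        linarith [hx.1]) continuousOn_id
    rw [hχ.logDefect_sub, ← integral_inv_of_pos hT0 hu0,
      ← intervalIntegral.integral_sub hinv (hχ.intervalIntegrable_defect _ _)]
    refine intervalIntegral.integral_congr fun t ht => ?_
    rw [uIcc_of_le hTu.le] at ht
    have : t ≠ 0 := by linarith [ht.1]
    field_simp
    ring
  have hmass0 : 0 < ∫ t in T..u, χ t / t * 1 := by
    rw [hmass]
    refine (sub_nonneg.2 (hχ.logDefect_sub_le hT0 hTu.le)).lt_of_ne' fun h => hne ?_
    have h8 : logDefect χ u = logDefect χ T + Real.log (u / T) := by linarith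
    rw [Echi_eq_exp, Echi_eq_exp, h8, Real.exp_add, Real.exp_log (div_pos hu0 hT0)]
  have h8 : μ * ∫ t in T..u, χ t / t * 1
      ≤ ∫ t in T..u, χ t / t * (σ (u - t) - dickmanRho (Echi χ t * (u / t) - 1)) := by
    rw [← intervalIntegral.integral_const_mul]
    refine intervalIntegral.integral_mono_on hTu.le
      ((hχ.intervalIntegrable_div_mul (f := fun _ => 1) continuous_const hT hTu.le).const_mul _)
      hint fun t ht => ?_
    rw [mul_one, mul_comm]
    refine mul_le_mul_of_nonneg_left ?_ (div_nonneg (hχ.nonneg t) (by linarith [ht.1]))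
    have h9 := hmin ht
    have h10 := hχ.dickmanRho_Echi_le (hσ.mono (show u - t ≤ u by linarith [ht.1]))
    simp only [mem_ofPred_eq] at h9
    linarith
  have h9 := mul_pos hμ0 hmass0
  linarith

end IsKernel

namespace IsKernel

variable {χ : ℝ → ℝ} (hχ : IsKernel χ)

include hχ

theorem ae_eq_one_of_Echi_eq_one {c : ℝ} (hc : 0 ≤ c) (h : Echi χ c = 1) :
    ∀ᵐ t : ℝ, t ∈ Icc 0 c → χ t = 1 := by
  have h0 : ∫ t in (0 : ℝ)..c, (1 - χ t) / t = 0 := by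
    rw [Echi_eq_exp, Real.exp_eq_one_iff] at h
    exact h
  rw [intervalIntegral.integral_eq_zero_iff_of_le_of_nonneg_ae hc
    (ae_of_all _ fun t => hχ.defect_nonneg t) (hχ.intervalIntegrable_defect _ _)] at h0
  filter_upwards [(ae_restrict_iff' measurableSet_Ioc).1 h0] with t ht htm
  rcases htm.1.eq_or_lt with rfl | ht0
  · exact hχ.eq_one 0 zero_le_one
  · have h1 := ht ⟨ht0, htm.2⟩
    simp only [Pi.zero_apply, div_eq_zero_iff, ht0.ne', or_false] at h1
    linarith

/-- If `E(c) = 1`, then the largest possible value of `E(u)` is `u / c`, and it is attained only by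
kernels vanishing on `[c, u]`. -/
theorem ae_eq_zero_of_Echi_eq_one {c u : ℝ} (hc : 0 < c) (hcu : c ≤ u) (h : Echi χ c = 1)
    (hu : Echi χ u = u / c) : ∀ᵐ t : ℝ, t ∈ Icc c u → χ t = 0 := by
  have hinv : IntervalIntegrable (fun t : ℝ => t⁻¹) volume c u :=
    intervalIntegral.intervalIntegrable_inv (fun x hx => by
      rw [uIcc_of_le hcu] at hx
      linarith [hx.1]) continuousOn_id
  have h0 : ∫ t in c..u, (t⁻¹ - (1 - χ t) / t) = 0 := by
    rw [intervalIntegral.integral_sub hinv (hχ.intervalIntegrable_defect _ _),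
      integral_inv_of_pos hc (hc.trans_le hcu), ← hχ.logDefect_sub, ← log_Echi, ← log_Echi, h, hu]
    simp
  rw [intervalIntegral.integral_eq_zero_iff_of_le_of_nonneg_ae hcu
    ((ae_restrict_iff' measurableSet_Ioc).2 (ae_of_all _ fun t ht =>
      sub_nonneg.2 (hχ.defect_le_inv (hc.trans ht.1))))
    (hinv.sub (hχ.intervalIntegrable_defect _ _))] at h0
  have hne : ∀ᵐ t : ℝ, t ≠ c := by simp [ae_iff]
  filter_upwards [(ae_restrict_iff' measurableSet_Ioc).1 h0, hne] with t ht htc htm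
  have ht0 : t ≠ 0 := by linarith [htm.1]
  have h1 := ht ⟨htm.1.lt_of_ne' htc, htm.2⟩
  simp only [Pi.zero_apply] at h1
  field_simp at h1
  linarith

end IsKernel

/-! ### Normalisation of kernels and solutions -/

theorem IsChi.exists_isKernel {χ : ℝ → ℝ} (hχ : IsChi χ) :
    ∃ χ' : ℝ → ℝ, IsKernel χ' ∧ ∀ᵐ t : ℝ, 0 ≤ t → χ t = χ' t := by
  obtain ⟨g, hg, hgχ⟩ := hχ.aemeasurable
  refine ⟨fun t => if t ≤ 1 then 1 else max 0 (min 1 (g t)), ⟨?_, ?_, ?_, ?_⟩, ?_⟩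
  · exact Measurable.ite measurableSet_Iic measurable_const
      (measurable_const.max (measurable_const.min hg))
  · intro t
    split_ifs
    exacts [zero_le_one, le_max_left _ _]
  · intro t
    split_ifs
    exacts [le_rfl, max_le zero_le_one (min_le_left _ _)]
  · intro t ht
    exact if_pos ht
  · filter_upwards [(ae_restrict_iff' measurableSet_Ici).1 hgχ] with t ht ht0
    rcases le_or_gt t 1 with h | h
    · rw [if_pos h, hχ.eq_one t ht0 h]
    · have := hχ.mem_Icc t h
      rw [if_neg (not_le.2 h), ← ht ht0, min_eq_right this.2, max_eq_right this.1]

theorem Echi_congr_of_ae {χ χ' : ℝ → ℝ} (h : ∀ᵐ t : ℝ, 0 ≤ t → χ t = χ' t) {u : ℝ} (hu : 0 ≤ u) :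
    Echi χ u = Echi χ' u := by
  unfold Echi
  congr 1
  refine intervalIntegral.integral_congr_ae ?_
  filter_upwards [h] with t ht htm
  rw [uIoc_of_le hu] at htm
  rw [ht htm.1.le]

theorem IsSigma.solvesUpTo {χ χ' σ : ℝ → ℝ} (hσ : IsSigma χ σ)
    (h : ∀ᵐ t : ℝ, 0 ≤ t → χ t = χ' t) (X : ℝ) : SolvesUpTo χ' (fun v => σ (max 0 v)) X where
  continuous := hσ.continuousOn.comp_continuous (by fun_prop) fun v => le_max_left 0 v
  eq_one u hu := hσ.eq_one _ (le_max_left _ _) (max_le zero_le_one hu)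
  integral_eq u hu _ := by
    rw [max_eq_right (by linarith), hσ.integral_eq u hu]
    refine intervalIntegral.integral_congr_ae ?_
    filter_upwards [h] with t ht htm
    rw [uIoc_of_le (by linarith)] at htm
    rw [ht htm.1.le, max_eq_right (by linarith [htm.2])]

/-- The value `ρ(w)` is attained by the kernel `1_{[0, 1]}` at `u = w`. -/
theorem dickmanRho_mem_sigmaValues {w : ℝ} (hw : 1 ≤ w) : dickmanRho w ∈ sigmaValues w := by
  have hk := isKernel_indicator
  refine ⟨fun t => if t ≤ 1 then 1 else 0, dickmanRho, w,
    ⟨hk.measurable.aemeasurable, fun t _ h => hk.eq_one t h, fun t _ => ⟨hk.nonneg t, hk.le_one t⟩⟩,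
    ⟨continuous_dickmanRho.continuousOn, fun u _ h => dickmanRho_of_le_one h, fun u hu =>
      (integral_indicator_mul_dickmanRho hu).symm⟩, hw, ?_, rfl⟩
  have h1 := hk.logDefect_sub 1 w
  have h2 : ∫ x in (1 : ℝ)..w, (1 - (if x ≤ 1 then (1 : ℝ) else 0)) / x = Real.log w := by
    rw [← div_one w, ← integral_inv_of_pos one_pos (by linarith), div_one]
    refine intervalIntegral.integral_congr_ae (ae_of_all _ fun x hx => ?_)
    rw [uIoc_of_le hw] at hx
    rw [if_neg (not_le.2 hx.1), sub_zero, one_div]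
  rw [h2, hk.logDefect_of_le_one le_rfl, sub_zero] at h1
  rw [Echi_eq_exp, h1, Real.exp_log (by linarith)]

theorem theorem5 :
    (∀ χ σ : ℝ → ℝ, IsChi χ → IsSigma χ σ → ∀ u : ℝ, 0 ≤ u →
      dickmanRho (Echi χ u) ≤ σ u ∧
      (1 ≤ Echi χ u → Echi χ u ≤ 2 → σ u = dickmanRho (Echi χ u) → Echi χ (u / 2) = 1) ∧
      (2 ≤ Echi χ u → σ u = dickmanRho (Echi χ u) →
        Echi χ (u / Echi χ u) = 1 ∧
        (∀ᵐ t : ℝ, t ∈ Icc 0 (u / Echi χ u) → χ t = 1) ∧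
        (∀ᵐ t : ℝ, t ∈ Icc (u / Echi χ u) u → χ t = 0))) ∧
    (∀ w : ℝ, 1 ≤ w → IsLeast (sigmaValues w) (dickmanRho w)) := by
  have main : ∀ χ σ : ℝ → ℝ, IsChi χ → IsSigma χ σ → ∀ u : ℝ, 0 ≤ u →
      dickmanRho (Echi χ u) ≤ σ u ∧
      (1 ≤ Echi χ u → Echi χ u ≤ 2 → σ u = dickmanRho (Echi χ u) → Echi χ (u / 2) = 1) ∧
      (2 ≤ Echi χ u → σ u = dickmanRho (Echi χ u) →
        Echi χ (u / Echi χ u) = 1 ∧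
        (∀ᵐ t : ℝ, t ∈ Icc 0 (u / Echi χ u) → χ t = 1) ∧
        (∀ᵐ t : ℝ, t ∈ Icc (u / Echi χ u) u → χ t = 0)) := by
    intro χ σ hχ hσ u hu
    obtain ⟨χ', hχ', hae⟩ := hχ.exists_isKernel
    have hτ := hσ.solvesUpTo hae u
    have hE : ∀ v, 0 ≤ v → Echi χ v = Echi χ' v := fun v hv => Echi_congr_of_ae hae hv
    have hτu : (fun v => σ (max 0 v)) u = σ u := by simp only [max_eq_right hu]
    have hEpos := Echi_pos χ' u
    have hE1 := hχ'.one_le_Echi u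
    rw [hE u hu, hE (u / 2) (by positivity), hE (u / Echi χ' u) (by positivity), ← hτu]
    refine ⟨hχ'.dickmanRho_Echi_le hτ, fun _ h2 heq => hχ'.Echi_half_eq_one hτ h2 heq,
      fun h2 heq => ?_⟩
    have hc : Echi χ' (u / Echi χ' u) = 1 := by
      rcases h2.eq_or_lt with h | h
      · rw [← h]
        exact hχ'.Echi_half_eq_one hτ h.ge heq
      · exact hχ'.Echi_div_eq_one_of_two_lt hτ h heq
    have hu0 : 0 < u := by
      rcases hu.eq_or_lt with rfl | h
      · rw [hχ'.Echi_of_le_one zero_le_one] at h2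
        norm_num at h2
      · exact h
    have hcpos : 0 < u / Echi χ' u := by positivity
    refine ⟨hc, ?_, ?_⟩
    · filter_upwards [hae, hχ'.ae_eq_one_of_Echi_eq_one hcpos.le hc] with t h3 h4 ht
      rw [h3 ht.1, h4 ht]
    · filter_upwards [hae, hχ'.ae_eq_zero_of_Echi_eq_one hcpos (div_le_self hu hE1) hc
        (by field_simp)] with t h3 h4 ht
      rw [h3 (hcpos.le.trans ht.1), h4 ht]
  refine ⟨main, fun w hw => ⟨dickmanRho_mem_sigmaValues hw, ?_⟩⟩
  rintro s ⟨χ, σ, u, hχ, hσ, hu, rfl, rfl⟩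
  exact (main χ σ hχ hσ u (by linarith)).1
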